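/- **Theorem (Soundness of the axiomatic proof calculus of dLCHP).** *Syntax.* Variables are real ($V_{\mathbb R}$, closed under $x\mapsto x'$, with designated global time $\mu$), integer ($V_{\mathbb N}$), and trace variables ($V_T$); $\Omega$ is the set of channels. Sets $Y\subseteq\Omega$ and sets of variables $\bar z\subseteq V_{\mathbb R}\cup V_T$, $\bar h\subseteq V_T$ below are finite or cofinite (in each sort), and complements $\bar z^{\complement}$ of indices are taken in $V_{\mathbb R}\cup V_T$. $\theta$ denotes polynomials over $V_{\mathbb R}$ with rational coefficients and $\chi$ formulas of first-order real arithmetic, both possibly with function symbols $f$ and predicate symbols $q_{\mathbb R}$ standing for such expressions. Terms are real, integer, channel or trace terms built from variables, symbols $f(Y,\bar e)$, constants, $+$, $\cdot$, differentials $(\theta)'$, value/time stamp/channel of the last event, length, communication items $\langle ch,\theta_1,\theta_2\rangle$, concatenation, projection $te\downarrow Y$ and access $te[ie]$. Programs are $$\alpha,\beta ::= a_{Y,\bar z}\mid x:=\theta\mid x:=*\mid ?\chi\mid\{\bar x'=\bar\theta\,\&\,\chi\}\mid\alpha;\beta\mid\alpha\cup\beta\mid\alpha^*\mid ch(h)!\theta\mid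 ch(h)?x\mid\alpha\parallel\beta ,$$ where $a_{Y,\bar z}$ is a program constant that only writes channels in $Y$ and only binds variables in $\bar z$ ($a$ abbreviates $a_{\Omega,V_{\mathbb R}\cup V_T}$), and parallel programs share no bound variables except $\{\mu,\mu'\}\cup V_T$. Formulas are built from $e_1\sim e_2$ ($=$; $\ge$ on numbers; prefix on traces), $p(Y,\bar e)$, $\neg,\wedge,\forall z$, boxes $[\alpha]\psi$ and ac-boxes $[\alpha]_{\{A,C\}}\psi$, where $A,C$ depend on no variable bound by $\alpha$ other than trace variables. *Semantics.* A trace value is a finite sequence of events $\langle ch,a,t\rangle$; a recorded trace $\tau$ has events that also carry a trace variable. States $v$ give values to all variables; $v\cdot\tau$ appends to each $v(h)$ the events of $\tau$ recorded by $h$; $\downarrow Y$ is projection onto channels in $Y$, and $v\downarrow Y$ projects all trace variables. Programs denote sets of computations $(v,\tau,w)$ with $w$ a state or $\bot$ (unfinished); $(\tau',w')\preceq(\tau,w)$ iff these are equal, or $w'=\bot$ and $\tau'$ is a prefix of $\tau$. A computation is chronological if time stamps do not decrease along $\tau$, are $\ge v(\mu)$, and, if $w\ne\bot$, are $\le w(\mu)$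 with $v(\mu)\le w(\mu)$. An interpretation $I$ gives functions (real-valued ones being smooth in their real arguments) and relations to function and predicate symbols, $f(Y,\bar e)$ and $p(Y,\bar e)$ being evaluated with arguments taken in $v\downarrow Y$. To $a_{Y,\bar z}$ it gives a prefix-closed set $D$ of chronological computations, containing all $(v,\epsilon,\bot)$, such that $\tau\downarrow Y^{\complement}=\epsilon$ and, if $w\neq\bot$, $w=v$ on $V_T$ and $w\cdot\tau=v$ off $\bar z$, and such that $D$ does not depend on the recorded history: if $(v,\tau,w)\in D$ and $v'=v$ off $V_T$, then $(v',\tau,w')\in D$ where $w'=\bot$ if $w=\bot$, and otherwise $w'=w$ off $V_T$ and $w'=v'$ on $V_T$. Assignments, tests and ODEs denote all $(v,\epsilon,\bot)$ together with their usual final states; an ODE is followed for some duration $r\ge0$ within $\chi$, with $\mu'=1$ always included, and all variables other than $\bar x,\bar x',\mu,\mu'$ constant. $ch(h)!\theta$ denotes all $(v,\tau,w)$ with $(\tau,w)\preceq(\langle h,ch,v(\theta),v(\mu)\rangle,v)$, and $ch(h)?x$ those with $(\tau,w)\preceq(\langle h,ch,d,v(\mu)\rangle,v[x\mapsto d])$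 for some $d\in\mathbb R$. $\alpha;\beta$ denotes all $(v,\tau,\bot)$ with $(v,\tau,w)\in[\![\alpha]\!]$ for some $w$, and all $(v,\tau_1\tau_2,w)$ with $(v,\tau_1,u)\in[\![\alpha]\!]$, $u\ne\bot$, and $(u,\tau_2,w)\in[\![\beta]\!]$; $\cup$ is union; $\alpha^*=\bigcup_n\alpha^n$ with $\alpha^0\equiv{?\mathit{true}}$, $\alpha^{n+1}\equiv\alpha;\alpha^n$. The bound variables of $\alpha$ are those $z$ with $(w\cdot\tau)(z)\ne v(z)$ for some computation of $\alpha$ with $w\neq\bot$ in some interpretation, and its written channels those occurring in $\tau$ for some computation in some interpretation. $\alpha\parallel\beta$ denotes all $(v,\tau,w)$, $\tau$ chronological and using only channels written by $\alpha$ or $\beta$, such that the projections of $\tau$ to the channels written by $\alpha$, resp. $\beta$, belong to computations of $\alpha$, $\beta$ from $v$ to some $w_\alpha$, $w_\beta$ that are both $\bot$ or have equal global time, where $w=\bot$ if both are $\bot$, and otherwise $w=w_\alpha$ on the bound variables of $\alpha$ and $w=w_\beta$ elsewhere. $v\models[\alpha]\psi$ iff $w\cdot\tau\models\psi$ for all $(v,\tau,w)\in[\![\alpha]\!]$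 with $w\neq\bot$. $v\models[\alpha]_{\{A,C\}}\psi$ iff for all $(v,\tau,w)\in[\![\alpha]\!]$: if $v\cdot\tau'\models A$ for all strict prefixes $\tau'$ of $\tau$, then $v\cdot\tau\models C$; and if $v\cdot\tau'\models A$ for all prefixes $\tau'$ of $\tau$ and $w\neq\bot$, then $w\cdot\tau\models\psi$. A formula is valid if it is true in all states of all interpretations. *Calculus.* Let $P_j\equiv p_j(Y,\bar z)$, $A_j\equiv r_j(Y,\bar h)$, $C_j\equiv q_j(Y,\bar h)$ with predicate symbols $p_j,r_j,q_j$ ($j$ may be blank) and $\widehat r\equiv r(ch,h)$, $\widehat q\equiv q(ch,h)$, $\widehat p\equiv p(ch,h)$. Let $\bar x$ be distinct real variables other than $\mu$, $h_0\ne h$ trace variables, and in (comDual) $x\neq\mu$. The axioms are - (assign) $[x:=f]p(x)\leftrightarrow p(f)$; (nondetAssign) $[x:=*]P\leftrightarrow\forall x\,P$; (test) $[?q_{\mathbb R}]P\leftrightarrow(q_{\mathbb R}\to P)$; - (boxesDual) $[a]P\leftrightarrow[a]_{\{\mathit{true},\mathit{true}\}}P$; - (acComposition) $[a;b]_{\{A,C\}}P\leftrightarrow[a]_{\{A,C\}}[b]_{\{A,C\}}P$;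 - (acChoice) $[a\cup b]_{\{A,C\}}P\leftrightarrow[a]_{\{A,C\}}P\wedge[b]_{\{A,C\}}P$; - (acIteration) $[a^*]_{\{A,C\}}P\leftrightarrow[a^0]_{\{A,C\}}P\wedge[a]_{\{A,C\}}[a^*]_{\{A,C\}}P$; - (assumptionWeak) $[a]_{\{\mathit{true},K\}}\mathit{true}\wedge[a]_{\{A_1\wedge A_2,\,C_1\wedge C_2\}}P\to[a]_{\{A,\,C_1\wedge C_2\}}P$ with $K\equiv(A\wedge C_1\to A_2)\wedge(A\wedge C_2\to A_1)$; - (acDropComp) $[\hat a]_{\{A,C\}}P\to[\hat a\parallel\hat b]_{\{A,C\}}P$ with $\hat a\equiv a_{Y_a,(\bar z_a\cap\bar z)\cup V_T\cup\{\mu,\mu'\}}$ and $\hat b\equiv b_{Y^{\complement}\cup Y_a,\,\bar z^{\complement}\cup V_T\cup\{\mu,\mu'\}}$, for any $Y_a,\bar z_a$; - (gtime) $[\{\bar x'=\bar f(\bar x,\mu)\,\&\,q_{\mathbb R}(\bar x,\mu)\}]p(\bar x,\mu)\leftrightarrow[\{\mu'=1,\bar x'=\bar f(\bar x,\mu)\,\&\,q_{\mathbb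 R}(\bar x,\mu)\}]p(\bar x,\mu)$; - (send) $[ch(h)!f]p(ch,h)\leftrightarrow\forall h_0\,(h_0=h\cdot\langle ch,f,\mu\rangle\to p(ch,h_0))$; - (acCom) $[ch(h)!f]_{\{\widehat r,\widehat q\}}\widehat p\leftrightarrow\widehat q\wedge(\widehat r\to[ch(h)!f](\widehat q\wedge(\widehat r\to\widehat p)))$; - (comDual) $[ch(h)?x]_{\{\widehat r,\widehat q\}}p(ch,h,x)\leftrightarrow[x:=*][ch(h)!x]_{\{\widehat r,\widehat q\}}p(ch,h,x)$; - (acNoCom) $[a_{\emptyset,V_{\mathbb R}}]_{\{A,C\}}P\leftrightarrow C\wedge(A\to[a_{\emptyset,V_{\mathbb R}}]P)$; - (acWeak) $[a]_{\{A,C\}}P\leftrightarrow C\wedge[a]_{\{A,C\}}(C\wedge(A\to P))$; - (acInduction) $[a^*]_{\{A,C\}}P\leftrightarrow[a^0]_{\{A,C\}}P\wedge[a^*]_{\{A,\mathit{true}\}}(P\to[a]_{\{A,C\}}P)$; - (acModalMP) $[a]_{\{A,\,C_1\to C_2\}}(P_1\to P_2)\to([a]_{\{A,C_1\}}P_1\to[a]_{\{A,C_2\}}P_2)$;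 and the rules are (MP) from $\varphi\to\psi$ and $\varphi$ infer $\psi$, and (acG) from $C\wedge P$ infer $[a]_{\{A,C\}}P$. *Claim.* The calculus is sound: every axiom is a well-formed valid formula; both rules are locally sound (whenever all premises are true in all states of an interpretation, so is the conclusion); hence every formula derivable from the axioms by the rules is well-formed and valid. -/

import Mathlib

noncomputable section

namespace DLCHP

open scoped ContDiff Classical

/-! ## Vocabulary, variables, channels -/

/-- The term sorts: real, integer (natural-number valued), channel and trace. -/
inductive Srt
  | real | int | chan | trace

/-- A vocabulary: names of variables of each sort, channel names, and the function, predicate and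
program symbols, each with its arity.  `PolSym` and `RPredSym` are the symbols standing for
polynomials and for formulas of first-order real arithmetic (the only ones allowed in programs).
Argument vectors of predicate symbols may be infinite, since `p(Y, z̄)` with a cofinite set of
variables `z̄` is a legal formula.  `chan0` is the conventional value of `chan(ε)`. -/
structure Vocab where
  RName : Type
  NName : Type
  TName : Type
  Chan : Type
  time : RName
  chan0 : Chan
  FSym : (n : ℕ) → (Fin n → Srt) → Srt → Type
  PolSym : ℕ → Type
  PSym : (ι : Type) → (ι → Srt) → Type
  RPredSym : ℕ → Type
  ASym : Type

/-- Real variables: every name `x` comes with its differential symbols `x', x'', …`. -/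
abbrev RVar (L : Vocab) : Type := L.RName × ℕ

/-- The differential symbol `x'` of `x`. -/
def RVar.prime {L : Vocab} (x : RVar L) : RVar L := (x.1, x.2 + 1)

/-- The variable `μ` of global time. -/
def gt (L : Vocab) : RVar L := (L.time, 0)

/-- A communication event `⟨ch, a, t⟩`. -/
structure Event (L : Vocab) where
  ch : L.Chan
  val : ℝ
  time : ℝ

/-- A recorded communication event `⟨h, ch, a, t⟩`. -/
structure REvent (L : Vocab) where
  recorder : L.TName
  ch : L.Chan
  val : ℝ
  time : ℝ

def REvent.event {L : Vocab} (e : REvent L) : Event L := ⟨e.ch, e.val, e.time⟩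

/-- The variables of each sort (there are no channel variables). -/
abbrev VarOf (L : Vocab) : Srt → Type
  | .real => RVar L
  | .int => L.NName
  | .chan => Empty
  | .trace => L.TName

/-- The values of each sort.  Trace values are arbitrary finite sequences of events (so that they are
closed under concatenation); being chronological is demanded of computations. -/
abbrev Val (L : Vocab) : Srt → Type
  | .real => ℝ
  | .int => ℕ
  | .chan => L.Chan
  | .trace => List (Event L)

/-- The set `V = V_ℝ ∪ V_ℕ ∪ V_T` of all variables. -/
abbrev Var (L : Vocab) : Type := Σ s : Srt, VarOf L s

abbrev rv {L : Vocab} (x : RVar L) : Var L := ⟨.real, x⟩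

abbrev tv {L : Vocab} (h : L.TName) : Var L := ⟨.trace, h⟩

/-! ## Finite and cofinite sets -/

def IsCofin {X : Type} (S : Set X) : Prop := S.Finite ∨ Sᶜ.Finite

theorem IsCofin.compl {X : Type} {S : Set X} (h : IsCofin S) : IsCofin Sᶜ := by
  rcases h with h | h
  · exact Or.inr (by rwa [compl_compl])
  · exact Or.inl h

theorem IsCofin.union {X : Type} {S T : Set X} (hS : IsCofin S) (hT : IsCofin T) :
    IsCofin (S ∪ T) := by
  rcases hS with hS | hS
  · rcases hT with hT | hT
    · exact Or.inl (hS.union hT)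
    · exact Or.inr (hT.subset (Set.compl_subset_compl.2 Set.subset_union_right))
  · exact Or.inr (hS.subset (Set.compl_subset_compl.2 Set.subset_union_left))

theorem IsCofin.inter {X : Type} {S T : Set X} (hS : IsCofin S) (hT : IsCofin T) :
    IsCofin (S ∩ T) := by
  have h := (hS.compl.union hT.compl).compl
  rwa [Set.compl_union, compl_compl, compl_compl] at h

theorem IsCofin.empty {X : Type} : IsCofin (∅ : Set X) := Or.inl Set.finite_empty

theorem IsCofin.univ {X : Type} : IsCofin (Set.univ : Set X) := Or.inr (by simp)

/-- Finite or cofinite channel sets. -/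
abbrev CSet (L : Vocab) : Type := {Y : Set L.Chan // IsCofin Y}

def CSet.empty (L : Vocab) : CSet L := ⟨∅, IsCofin.empty⟩

def CSet.all (L : Vocab) : CSet L := ⟨Set.univ, IsCofin.univ⟩

def CSet.single {L : Vocab} (c : L.Chan) : CSet L := ⟨{c}, Or.inl (Set.finite_singleton c)⟩

def CSet.compl {L : Vocab} (Y : CSet L) : CSet L := ⟨Y.1ᶜ, Y.2.compl⟩

def CSet.union {L : Vocab} (Y Y' : CSet L) : CSet L := ⟨Y.1 ∪ Y'.1, Y.2.union Y'.2⟩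

/-- The variables of sort `s` in `Z`. -/
def slice {L : Vocab} (Z : Set (Var L)) (s : Srt) : Set (VarOf L s) := {x | (⟨s, x⟩ : Var L) ∈ Z}

/-- All real and trace variables. -/
def realTrace (L : Vocab) : Set (Var L) := {x | x.1 = .real ∨ x.1 = .trace}

/-- Sets of real and trace variables that are finite or cofinite in each of the two sorts. -/
abbrev VSet (L : Vocab) : Type :=
  {Z : Set (Var L) // Z ⊆ realTrace L ∧ ∀ s, IsCofin (slice Z s)}

theorem isCofin_slice_sort {L : Vocab} (P : Srt → Prop) (s : Srt) :
    IsCofin (slice {x : Var L | P x.1} s) := by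
  by_cases h : P s
  · convert (IsCofin.univ : IsCofin (Set.univ : Set (VarOf L s)))
    ext x; simp [slice, h]
  · convert (IsCofin.empty : IsCofin (∅ : Set (VarOf L s)))
    ext x; simp [slice, h]

theorem isCofin_slice_single {L : Vocab} (y : Var L) (s : Srt) : IsCofin (slice {y} s) :=
  Or.inl ((Set.finite_singleton y).preimage (sigma_mk_injective.injOn))

def VSet.inter {L : Vocab} (Z Z' : VSet L) : VSet L :=
  ⟨Z.1 ∩ Z'.1, fun _ h => Z.2.1 h.1, fun s => (Z.2.2 s).inter (Z'.2.2 s)⟩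

def VSet.union {L : Vocab} (Z Z' : VSet L) : VSet L :=
  ⟨Z.1 ∪ Z'.1, Set.union_subset Z.2.1 Z'.2.1, fun s => (Z.2.2 s).union (Z'.2.2 s)⟩

/-- All real and trace variables, `V_ℝ ∪ V_T`. -/
def VSet.all (L : Vocab) : VSet L := ⟨realTrace L, subset_rfl, isCofin_slice_sort fun s => s = .real ∨ s = .trace⟩

/-- All real variables `V_ℝ`. -/
def VSet.reals (L : Vocab) : VSet L :=
  ⟨{x | x.1 = .real}, fun _ h => Or.inl h, isCofin_slice_sort fun s => s = .real⟩

/-- Complement within `V_ℝ ∪ V_T`. -/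
def VSet.compl {L : Vocab} (Z : VSet L) : VSet L :=
  ⟨realTrace L ∩ Z.1ᶜ, Set.inter_subset_left,
    fun s => (isCofin_slice_sort (fun s => s = .real ∨ s = .trace) s).inter (Z.2.2 s).compl⟩

/-- The variables `{μ, μ'} ∪ V_T` that parallel programs may share. -/
def shared (L : Vocab) : VSet L :=
  ⟨{x | x.1 = .trace} ∪ ({rv (gt L)} ∪ {rv (gt L).prime}), by
      rintro x (h | h | h)
      · exact Or.inr h
      · rw [Set.mem_singleton_iff] at h; subst h; exact Or.inl rfl
      · rw [Set.mem_singleton_iff] at h; subst h; exact Or.inl rfl,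
    fun s => (isCofin_slice_sort (fun s => s = .trace) s).union
      ((isCofin_slice_single (rv (gt L)) s).union (isCofin_slice_single (rv (gt L).prime) s))⟩

/-! ## Syntax -/

/-- Polynomials in `ℚ[V_ℝ]`, with function symbols that stand for polynomials. -/
inductive Poly (L : Vocab) : Type
  | var (x : RVar L)
  | rat (c : ℚ)
  | fn {n : ℕ} (f : L.PolSym n) (args : Fin n → Poly L)
  | add (θ η : Poly L)
  | mul (θ η : Poly L)

/-- Formulas of first-order real arithmetic, with predicate symbols that stand for such
formulas. -/
inductive RFml (L : Vocab) : Type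
  | eq (θ η : Poly L)
  | ge (θ η : Poly L)
  | pred {n : ℕ} (q : L.RPredSym n) (args : Fin n → Poly L)
  | neg (χ : RFml L)
  | and (χ ρ : RFml L)
  | all (x : RVar L) (χ : RFml L)

/-- The formula `true`. -/
def RFml.tru {L : Vocab} : RFml L := .eq (.rat 0) (.rat 0)

/-- Terms of all sorts. -/
inductive Term (L : Vocab) : Srt → Type
  | var {s : Srt} (x : VarOf L s) : Term L s
  | fn {n : ℕ} {s : Fin n → Srt} {r : Srt} (f : L.FSym n s r) (Y : CSet L)
      (args : ∀ i, Term L (s i)) : Term L r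
  | pfn {n : ℕ} (f : L.PolSym n) (args : Fin n → Term L .real) : Term L .real
  | rat (c : ℚ) : Term L .real
  | add (a b : Term L .real) : Term L .real
  | mul (a b : Term L .real) : Term L .real
  | diff (θ : Poly L) : Term L .real
  | val (t : Term L .trace) : Term L .real
  | stamp (t : Term L .trace) : Term L .real
  | zero : Term L .int
  | one : Term L .int
  | addInt (a b : Term L .int) : Term L .int
  | len (t : Term L .trace) : Term L .int
  | ch (c : L.Chan) : Term L .chan
  | chan (t : Term L .trace) : Term L .chan
  | nil : Term L .trace
  | item (c : L.Chan) (θ η : Poly L) : Term L .trace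
  | cat (t u : Term L .trace) : Term L .trace
  | proj (t : Term L .trace) (Y : CSet L) : Term L .trace
  | at (t : Term L .trace) (k : Term L .int) : Term L .trace

/-- Communicating hybrid programs.  `ode x θ χ` is the evolution along the ODE system
`x₁' = θ₁, …, xₙ' = θₙ` within `χ`; `send c h θ` is `c(h)!θ`, `recv c h x` is `c(h)?x`;
`const a Y Z` is the program constant `a` restricted to write channels in `Y` and to bind
variables in `Z`. -/
inductive Prog (L : Vocab) : Type
  | const (a : L.ASym) (Y : CSet L) (Z : VSet L)
  | assign (x : RVar L) (θ : Poly L)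
  | assignAny (x : RVar L)
  | test (χ : RFml L)
  | ode {n : ℕ} (x : Fin n → RVar L) (θ : Fin n → Poly L) (χ : RFml L)
  | seq (α β : Prog L)
  | choice (α β : Prog L)
  | loop (α : Prog L)
  | send (c : L.Chan) (h : L.TName) (θ : Poly L)
  | recv (c : L.Chan) (h : L.TName) (x : RVar L)
  | par (α β : Prog L)

/-- Formulas.  `acBox α A C ψ` is the ac-box `[α]{A, C}ψ`. -/
inductive Fml (L : Vocab) : Type 1
  | eq {s : Srt} (a b : Term L s)
  | geReal (a b : Term L .real)
  | geInt (a b : Term L .int)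
  | pref (a b : Term L .trace)
  | pred {ι : Type} {s : ι → Srt} (p : L.PSym ι s) (Y : CSet L) (args : ∀ i, Term L (s i))
  | rpred {n : ℕ} (q : L.RPredSym n) (args : Fin n → Term L .real)
  | neg (φ : Fml L)
  | and (φ ψ : Fml L)
  | all (x : Var L) (φ : Fml L)
  | box (α : Prog L) (ψ : Fml L)
  | acBox (α : Prog L) (A C ψ : Fml L)

def Fml.imp {L : Vocab} (φ ψ : Fml L) : Fml L := .neg (.and φ (.neg ψ))

def Fml.iff {L : Vocab} (φ ψ : Fml L) : Fml L := .and (.imp φ ψ) (.imp ψ φ)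

def Fml.tru {L : Vocab} : Fml L := .eq (.rat 0) (.rat 0)

/-! ## States, traces, computations -/

abbrev State (L : Vocab) : Type := (x : Var L) → Val L x.1

/-- Sequences of recorded events. -/
abbrev RTrace (L : Vocab) : Type := List (REvent L)

/-- Computations `(v, τ, w)`; the final state `none` is `⊥`, the mark of an unfinished
computation. -/
abbrev Comp (L : Vocab) : Type := State L × RTrace L × Option (State L)

def State.set {L : Vocab} (v : State L) (x : Var L) (d : Val L x.1) : State L :=
  Function.update v x d

/-- The projection `τ ↓ Y`. -/
def projT {L : Vocab} (Y : Set L.Chan) (τ : List (Event L)) : List (Event L) :=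
  τ.filter fun e => decide (e.ch ∈ Y)

/-- The projection `τ ↓ Y` of a recorded trace. -/
def projR {L : Vocab} (Y : Set L.Chan) (τ : RTrace L) : RTrace L :=
  τ.filter fun e => decide (e.ch ∈ Y)

/-- The state projection `v ↓ Y`. -/
def State.proj {L : Vocab} (v : State L) (Y : Set L.Chan) : State L
  | ⟨.trace, h⟩ => projT Y (v ⟨.trace, h⟩)
  | ⟨.real, x⟩ => v ⟨.real, x⟩
  | ⟨.int, x⟩ => v ⟨.int, x⟩
  | ⟨.chan, x⟩ => v ⟨.chan, x⟩

/-- The subtrace of `τ` recorded by `h`. -/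
def recorded {L : Vocab} (h : L.TName) (τ : RTrace L) : List (Event L) :=
  (τ.filter fun e => decide (e.recorder = h)).map REvent.event

/-- State-trace concatenation `v · τ`. -/
def State.cat {L : Vocab} (v : State L) (τ : RTrace L) : State L
  | ⟨.trace, h⟩ => v ⟨.trace, h⟩ ++ recorded h τ
  | ⟨.real, x⟩ => v ⟨.real, x⟩
  | ⟨.int, x⟩ => v ⟨.int, x⟩
  | ⟨.chan, x⟩ => v ⟨.chan, x⟩

/-- The state that agrees with `v` on trace variables and with `w` on all others. -/
def State.withTracesOf {L : Vocab} (w v : State L) : State L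
  | ⟨.trace, h⟩ => v ⟨.trace, h⟩
  | ⟨.real, x⟩ => w ⟨.real, x⟩
  | ⟨.int, x⟩ => w ⟨.int, x⟩
  | ⟨.chan, x⟩ => w ⟨.chan, x⟩

/-- The value of global time in a state. -/
def State.now {L : Vocab} (v : State L) : ℝ := v (rv (gt L))

/-- The prefix relation `(τ', w') ≼ (τ, w)` on observable behaviour. -/
def ObsPrefix {L : Vocab} (o' o : RTrace L × Option (State L)) : Prop :=
  (o'.2 = none ∧ o'.1 <+: o.1) ∨ o' = o

/-- Time stamps never decrease along a trace. -/
def ChronTrace {L : Vocab} (τ : RTrace L) : Prop := τ.Pairwise fun e e' => e.time ≤ e'.time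

/-- Chronological computations. -/
def Chron {L : Vocab} (v : State L) (τ : RTrace L) (w : Option (State L)) : Prop :=
  ChronTrace τ ∧ (∀ e ∈ τ, v.now ≤ e.time) ∧
    ∀ u, w = some u → v.now ≤ u.now ∧ ∀ e ∈ τ, e.time ≤ u.now

/-- The least denotation: unfinished computations without communication. -/
def least (L : Vocab) : Set (Comp L) := {c | c.2.1 = [] ∧ c.2.2 = none}

def PrefixClosed {L : Vocab} (D : Set (Comp L)) : Prop :=
  ∀ v o o', (v, o) ∈ D → ObsPrefix o' o → (v, o') ∈ D

/-- A denotation is independent of the communication recorded before it starts. -/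
def HistoryIndependent {L : Vocab} (D : Set (Comp L)) : Prop :=
  ∀ (v v' : State L) (τ : RTrace L) (w : Option (State L)),
    (∀ x : Var L, x.1 ≠ .trace → v x = v' x) → (v, τ, w) ∈ D →
      (v', τ, w.map fun u => u.withTracesOf v') ∈ D

/-! ## Interpretations -/

/-- Overwrite a value of sort real. -/
def overwriteReal {L : Vocab} : (s : Srt) → ℝ → Val L s → Val L s
  | .real, r, _ => r
  | .int, _, d => d
  | .chan, _, d => d
  | .trace, _, d => d

/-- Interpretations: functions (smooth in their real arguments if real-valued), relations, and,
for program constants, total prefix-closed sets of chronological computations that only write the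
channels `Y`, only bind the variables `Z`, and do not depend on the recorded history. -/
structure Interp (L : Vocab) : Type 1 where
  fn : ∀ {n : ℕ} {s : Fin n → Srt} {r : Srt}, L.FSym n s r → (∀ i, Val L (s i)) → Val L r
  fn_smooth : ∀ {n : ℕ} {s : Fin n → Srt} (f : L.FSym n s .real) (d : ∀ i, Val L (s i)),
    ContDiff ℝ ∞ fun ρ : Fin n → ℝ => (fn f (fun i => overwriteReal (s i) (ρ i) (d i)) : ℝ)
  pol : ∀ {n : ℕ}, L.PolSym n → (Fin n → ℝ) → ℝ
  pol_smooth : ∀ {n : ℕ} (f : L.PolSym n), ContDiff ℝ ∞ (pol f)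
  pred : ∀ {ι : Type} {s : ι → Srt}, L.PSym ι s → Set (∀ i, Val L (s i))
  rpred : ∀ {n : ℕ}, L.RPredSym n → Set (Fin n → ℝ)
  prog : L.ASym → CSet L → VSet L → Set (Comp L)
  prog_prefixClosed : ∀ a Y Z, PrefixClosed (prog a Y Z)
  prog_total : ∀ a Y Z, least L ⊆ prog a Y Z
  prog_chron : ∀ a Y Z v τ w, (v, τ, w) ∈ prog a Y Z → Chron v τ w
  prog_writes : ∀ a Y Z v τ w, (v, τ, w) ∈ prog a Y Z → projR Y.1ᶜ τ = []
  prog_binds : ∀ a Y Z v τ w, (v, τ, some w) ∈ prog a Y Z →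
    (∀ h, w (tv h) = v (tv h)) ∧ ∀ x, x ∉ Z.1 → w.cat τ x = v x
  prog_history : ∀ a Y Z, HistoryIndependent (prog a Y Z)

/-! ## Semantics of terms -/

def Poly.eval {L : Vocab} (I : Interp L) (v : State L) : Poly L → ℝ
  | .var x => v (rv x)
  | .rat c => c
  | .fn f args => I.pol f fun i => (args i).eval I v
  | .add θ η => θ.eval I v + η.eval I v
  | .mul θ η => θ.eval I v * η.eval I v

def RFml.sat {L : Vocab} (I : Interp L) : RFml L → State L → Prop
  | .eq θ η, v => θ.eval I v = η.eval I v
  | .ge θ η, v => θ.eval I v ≥ η.eval I v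
  | .pred q args, v => (fun i => (args i).eval I v) ∈ I.rpred q
  | .neg χ, v => ¬ χ.sat I v
  | .and χ ρ, v => χ.sat I v ∧ ρ.sat I v
  | .all x χ, v => ∀ d : ℝ, χ.sat I (v.set (rv x) d)

/-- Value of the differential `(θ)'`: the sum over all real variables of `x'` times the partial
derivative by `x` (only the finitely many variables of `θ` contribute). -/
def Poly.evalDiff {L : Vocab} (I : Interp L) (v : State L) (θ : Poly L) : ℝ :=
  ∑ᶠ x : RVar L, (v (rv x.prime) : ℝ) * deriv (fun r : ℝ => θ.eval I (v.set (rv x) r)) (v (rv x))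

/-- Evaluation of terms.  On the empty trace, `val` and `stamp` are `0` by convention; access
outside of a trace is the empty trace; positions are counted from `0`. -/
def Term.eval {L : Vocab} (I : Interp L) : {s : Srt} → Term L s → State L → Val L s
  | s, .var x, v => v ⟨s, x⟩
  | _, .fn f Y args, v => I.fn f fun i => (args i).eval I (v.proj Y.1)
  | _, .pfn f args, v => I.pol f fun i => (args i).eval I v
  | _, .rat c, _ => (c : ℝ)
  | _, .add a b, v => ((a.eval I v : ℝ) + (b.eval I v : ℝ) : ℝ)
  | _, .mul a b, v => ((a.eval I v : ℝ) * (b.eval I v : ℝ) : ℝ)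
  | _, .diff θ, v => θ.evalDiff I v
  | _, .val t, v => ((List.getLast? (t.eval I v : List (Event L))).elim 0 Event.val : ℝ)
  | _, .stamp t, v => ((List.getLast? (t.eval I v : List (Event L))).elim 0 Event.time : ℝ)
  | _, .zero, _ => (0 : ℕ)
  | _, .one, _ => (1 : ℕ)
  | _, .addInt a b, v => ((a.eval I v : ℕ) + (b.eval I v : ℕ) : ℕ)
  | _, .len t, v => List.length (t.eval I v : List (Event L))
  | _, .ch c, _ => c
  | _, .chan t, v => (List.getLast? (t.eval I v : List (Event L))).elim L.chan0 Event.ch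
  | _, .nil, _ => ([] : List (Event L))
  | _, .item c θ η, v => [(⟨c, θ.eval I v, η.eval I v⟩ : Event L)]
  | _, .cat t u, v => ((t.eval I v : List (Event L)) ++ (u.eval I v : List (Event L)))
  | _, .proj t Y, v => projT Y.1 (t.eval I v)
  | _, .at t k, v => ((t.eval I v : List (Event L))[(k.eval I v : ℕ)]?).toList

/-! ## Semantics of programs -/

/-- Denotations that still depend on the interpretation. -/
abbrev Den (L : Vocab) : Type 1 := Interp L → Set (Comp L)

/-- Bound variables, semantically. -/
def Den.bound {L : Vocab} (D : Den L) : Set (Var L) :=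
  {x | ∃ (I : Interp L) (v : State L) (τ : RTrace L) (w : State L),
    (v, τ, some w) ∈ D I ∧ w.cat τ x ≠ v x}

/-- Written channels, semantically. -/
def Den.written {L : Vocab} (D : Den L) : Set L.Chan :=
  {c | ∃ (I : Interp L) (v : State L) (τ : RTrace L) (w : Option (State L)),
    (v, τ, w) ∈ D I ∧ projR {c} τ ≠ []}

/-- Sequential composition of denotations. -/
def seqD {L : Vocab} (D E : Set (Comp L)) : Set (Comp L) :=
  {c | (∃ w, (c.1, c.2.1, w) ∈ D ∧ c.2.2 = none) ∨
    ∃ τ₁ u τ₂, (c.1, τ₁, some u) ∈ D ∧ (u, τ₂, c.2.2) ∈ E ∧ c.2.1 = τ₁ ++ τ₂}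

/-- Denotation of a test of the condition `P`. -/
def testD {L : Vocab} (P : State L → Prop) : Set (Comp L) :=
  least L ∪ {c | c.2.1 = [] ∧ c.2.2 = some c.1 ∧ P c.1}

/-- `n`-fold repetition, where `α⁰` is `?true` and `αⁿ⁺¹` is `α; αⁿ`. -/
def iterD {L : Vocab} (D : Set (Comp L)) : ℕ → Set (Comp L)
  | 0 => testD fun _ => True
  | n + 1 => seqD D (iterD D n)

/-- Runs of the ODE system `x' = θ` within `χ`, with `μ' = 1` always included.  On a degenerate
interval `[0, 0]` the derivative condition holds for every value, as usual. -/
def odeD {L : Vocab} (I : Interp L) {n : ℕ} (x : Fin n → RVar L) (θ : Fin n → Poly L)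
    (χ : RFml L) : Set (Comp L) :=
  least L ∪ {c | c.2.1 = [] ∧ ∃ (r : ℝ) (σ : ℝ → State L), 0 ≤ r ∧
    (∀ y : Var L, y ≠ rv (gt L).prime → (∀ i, y ≠ rv (x i).prime) → c.1 y = σ 0 y) ∧
    c.2.2 = some (σ r) ∧
    ∀ ζ ∈ Set.Icc 0 r,
      (σ ζ (rv (gt L).prime) : ℝ) = 1 ∧
      (∀ i, (σ ζ (rv (x i).prime) : ℝ) = (θ i).eval I (σ ζ)) ∧
      χ.sat I (σ ζ) ∧
      (∀ y : Var L, y ≠ rv (gt L) → y ≠ rv (gt L).prime →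
        (∀ i, y ≠ rv (x i) ∧ y ≠ rv (x i).prime) → σ ζ y = σ 0 y) ∧
      HasDerivWithinAt (fun t => (σ t (rv (gt L)) : ℝ)) (σ ζ (rv (gt L).prime) : ℝ)
        (Set.Icc 0 r) ζ ∧
      ∀ i, HasDerivWithinAt (fun t => (σ t (rv (x i)) : ℝ)) (σ ζ (rv (x i).prime) : ℝ)
        (Set.Icc 0 r) ζ}

/-- The merged final state of a parallel composition whose left program binds the variables
`B`. -/
def merge {L : Vocab} (B : Set (Var L)) : Option (State L) → Option (State L) → Option (State L)
  | some w₁, some w₂ => some fun x => if x ∈ B then w₁ x else w₂ x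
  | _, _ => none

/-- Parallel composition: the projections of the trace to the channels written by either program are
runs of that program, ending at the same global time, and there is no other communication. -/
def parD {L : Vocab} (D E : Den L) : Den L := fun I =>
  {c | ∃ w₁ w₂ : Option (State L),
    (c.1, projR D.written c.2.1, w₁) ∈ D I ∧ (c.1, projR E.written c.2.1, w₂) ∈ E I ∧
    w₁.map State.now = w₂.map State.now ∧
    ChronTrace c.2.1 ∧ projR (D.written ∪ E.written) c.2.1 = c.2.1 ∧
    c.2.2 = merge D.bound w₁ w₂}

/-- The denotation `⟦α⟧ I`. -/
def Prog.sem {L : Vocab} : Prog L → Den L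
  | .const a Y Z => fun I => I.prog a Y Z
  | .assign x θ => fun I =>
      least L ∪ {c | c.2.1 = [] ∧ c.2.2 = some (c.1.set (rv x) (θ.eval I c.1))}
  | .assignAny x => fun _ =>
      least L ∪ {c | c.2.1 = [] ∧ ∃ d : ℝ, c.2.2 = some (c.1.set (rv x) d)}
  | .test χ => fun I => testD fun v => χ.sat I v
  | .ode x θ χ => fun I => odeD I x θ χ
  | .seq α β => fun I => seqD (α.sem I) (β.sem I)
  | .choice α β => fun I => α.sem I ∪ β.sem I
  | .loop α => fun I => ⋃ n, iterD (α.sem I) n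
  | .send c h θ => fun I =>
      {k | ObsPrefix k.2 ([⟨h, c, θ.eval I k.1, k.1.now⟩], some k.1)}
  | .recv c h x => fun _ =>
      {k | ∃ d : ℝ, ObsPrefix k.2 ([⟨h, c, d, k.1.now⟩], some (k.1.set (rv x) d))}
  | .par α β => parD α.sem β.sem

/-! ## Semantics of formulas -/

def Fml.sat {L : Vocab} (I : Interp L) : Fml L → State L → Prop
  | .eq a b, v => a.eval I v = b.eval I v
  | .geReal a b, v => (a.eval I v : ℝ) ≥ (b.eval I v : ℝ)
  | .geInt a b, v => (a.eval I v : ℕ) ≥ (b.eval I v : ℕ)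
  | .pref a b, v => (a.eval I v : List (Event L)) <+: (b.eval I v : List (Event L))
  | .pred p Y args, v => (fun i => (args i).eval I (v.proj Y.1)) ∈ I.pred p
  | .rpred q args, v => (fun i => ((args i).eval I v : ℝ)) ∈ I.rpred q
  | .neg φ, v => ¬ φ.sat I v
  | .and φ ψ, v => φ.sat I v ∧ ψ.sat I v
  | .all x φ, v => ∀ d : Val L x.1, φ.sat I (v.set x d)
  | .box α ψ, v => ∀ τ w, (v, τ, some w) ∈ α.sem I → ψ.sat I (w.cat τ)
  | .acBox α A C ψ, v => ∀ τ w, (v, τ, w) ∈ α.sem I →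
      ((∀ τ', τ' <+: τ → τ' ≠ τ → A.sat I (v.cat τ')) → C.sat I (v.cat τ)) ∧
      (∀ u, w = some u → (∀ τ', τ' <+: τ → A.sat I (v.cat τ')) → ψ.sat I (u.cat τ))

/-- Validity: truth in all states of all interpretations. -/
def Fml.Valid {L : Vocab} (φ : Fml L) : Prop := ∀ (I : Interp L) (v : State L), φ.sat I v

/-! ## Context-sensitive syntax -/

/-- Free variables of a formula, semantically. -/
def Fml.free {L : Vocab} (φ : Fml L) : Set (Var L) :=
  {x | ∃ (I : Interp L) (v v' : State L), (∀ y, y ≠ x → v y = v' y) ∧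
    ¬ (φ.sat I v ↔ φ.sat I v')}

/-- Well-formed programs: parallel programs share no bound variables except for `{μ, μ'} ∪ V_T`
(and the variables of an ODE system are distinct). -/
def Prog.WF {L : Vocab} : Prog L → Prop
  | .ode x _ _ => Function.Injective x
  | .seq α β => α.WF ∧ β.WF
  | .choice α β => α.WF ∧ β.WF
  | .loop α => α.WF
  | .par α β => α.WF ∧ β.WF ∧ α.sem.bound ∩ β.sem.bound ⊆ (shared L).1
  | _ => True

/-- Well-formed formulas: ac-formulas depend on no variables bound by the program except for
trace variables. -/
def Fml.WF {L : Vocab} : Fml L → Prop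
  | .neg φ => φ.WF
  | .and φ ψ => φ.WF ∧ ψ.WF
  | .all _ φ => φ.WF
  | .box α ψ => α.WF ∧ ψ.WF
  | .acBox α A C ψ => α.WF ∧ A.WF ∧ C.WF ∧ ψ.WF ∧
      (A.free ∪ C.free) ∩ α.sem.bound ⊆ {x | x.1 = .trace}
  | _ => True

/-! ## The calculus -/

/-- The parameters of the symbolic formulas `A = r(Y, h̄)`, `C = q(Y, h̄)` and `P = p(Y, z̄)` of an
axiom: (co)finite sets `Y` of channels, `h̄` of trace variables, and `z̄` of real and trace
variables, the latter two listed as argument vectors. -/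
structure Args (L : Vocab) : Type 1 where
  Y : CSet L
  H : Type
  h : H → L.TName
  h_cofin : IsCofin (Set.range h)
  Z : Type
  s : Z → Srt
  z : (i : Z) → VarOf L (s i)
  zset : VSet L
  range_z : Set.range (fun i => (⟨s i, z i⟩ : Var L)) = zset.1

/-- Predicate symbols with arguments `h̄`. -/
abbrev Args.HSym {L : Vocab} (S : Args L) : Type := L.PSym S.H fun _ => .trace

/-- Predicate symbols with arguments `z̄`. -/
abbrev Args.ZSym {L : Vocab} (S : Args L) : Type := L.PSym S.Z S.s

/-- The ac-formula `r(Y, h̄)`. -/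
def Args.ac {L : Vocab} (S : Args L) (r : S.HSym) : Fml L :=
  .pred r S.Y fun i => .var (S.h i)

/-- The postcondition `p(Y, z̄)`. -/
def Args.post {L : Vocab} (S : Args L) (p : S.ZSym) : Fml L :=
  .pred p S.Y fun i => .var (S.z i)

/-- The unrestricted program constant `a`. -/
def Prog.pc {L : Vocab} (a : L.ASym) : Prog L := .const a (CSet.all L) (VSet.all L)

/-- The program constant `a` restricted to no communication and to real variables. -/
def Prog.noCom {L : Vocab} (a : L.ASym) : Prog L := .const a (CSet.empty L) (VSet.reals L)

/-- The program `α⁰`, that is `?true`. -/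
def Prog.zero {L : Vocab} : Prog L := .test .tru

/-- The left component of the well-formed parallel composition: `a` with channels `Y` and
variables `(zₐ ∩ z) ∪ V_T ∪ {μ, μ'}`. -/
def wfLeft {L : Vocab} (z : VSet L) (a : L.ASym) (Y : CSet L) (za : VSet L) : Prog L :=
  .const a Y ((za.inter z).union (shared L))

/-- The right component of the well-formed parallel composition: `b` with channels `Y` and
variables `(z_b ∩ zᶜ) ∪ V_T ∪ {μ, μ'}`. -/
def wfRight {L : Vocab} (z : VSet L) (b : L.ASym) (Y : CSet L) (zb : VSet L) : Prog L :=
  .const b Y ((zb.inter z.compl).union (shared L))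

/-- The formula `p(c, h)`. -/
def hist {L : Vocab} (c : L.Chan) (h : L.TName) (p : L.PSym (Fin 1) fun _ => .trace) : Fml L :=
  .pred p (CSet.single c) fun _ => .var h

/-- The formula `p(c, h, x)`. -/
def histVal {L : Vocab} (c : L.Chan) (h : L.TName) (x : RVar L)
    (p : L.PSym (Fin 2) ![.trace, .real]) : Fml L :=
  .pred p (CSet.single c) fun i => match i with
    | 0 => .var (s := .trace) h
    | 1 => .var (s := .real) x

/-- The compositionality condition `(A ∧ C₁ → A₂) ∧ (A ∧ C₂ → A₁)`. -/
def compCond {L : Vocab} (A A₁ A₂ C₁ C₂ : Fml L) : Fml L :=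
  .and (.imp (.and A C₁) A₂) (.imp (.and A C₂) A₁)

/-- The vector `(x, μ)` of variables, as polynomials. -/
def withTime {L : Vocab} {n : ℕ} (x : Fin n → RVar L) : Fin (n + 1) → RVar L :=
  Fin.snoc (α := fun _ => RVar L) x (gt L)

/-- The axioms. -/
inductive Axm {L : Vocab} : Fml L → Prop
  | assign (x : RVar L) (f : L.PolSym 0) (p : L.PSym (Fin 1) fun _ => .real) :
      Axm (.iff (.box (.assign x (.fn f Fin.elim0)) (.pred p (CSet.empty L) fun _ => .var x))
        (.pred p (CSet.empty L) fun _ => .pfn f Fin.elim0))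
  | nondetAssign (S : Args L) (x : RVar L) (p : S.ZSym) :
      Axm (.iff (.box (.assignAny x) (S.post p)) (.all (rv x) (S.post p)))
  | test (S : Args L) (q : L.RPredSym 0) (p : S.ZSym) :
      Axm (.iff (.box (.test (.pred q Fin.elim0)) (S.post p))
        (.imp (.rpred q Fin.elim0) (S.post p)))
  | boxesDual (S : Args L) (a : L.ASym) (p : S.ZSym) :
      Axm (.iff (.box (.pc a) (S.post p)) (.acBox (.pc a) .tru .tru (S.post p)))
  | acComposition (S : Args L) (a b : L.ASym) (r q : S.HSym) (p : S.ZSym) :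
      Axm (.iff (.acBox (.seq (.pc a) (.pc b)) (S.ac r) (S.ac q) (S.post p))
        (.acBox (.pc a) (S.ac r) (S.ac q)
          (.acBox (.pc b) (S.ac r) (S.ac q) (S.post p))))
  | acChoice (S : Args L) (a b : L.ASym) (r q : S.HSym) (p : S.ZSym) :
      Axm (.iff (.acBox (.choice (.pc a) (.pc b)) (S.ac r) (S.ac q) (S.post p))
        (.and (.acBox (.pc a) (S.ac r) (S.ac q) (S.post p))
          (.acBox (.pc b) (S.ac r) (S.ac q) (S.post p))))
  | acIteration (S : Args L) (a : L.ASym) (r q : S.HSym) (p : S.ZSym) :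
      Axm (.iff (.acBox (.loop (.pc a)) (S.ac r) (S.ac q) (S.post p))
        (.and (.acBox .zero (S.ac r) (S.ac q) (S.post p))
          (.acBox (.pc a) (S.ac r) (S.ac q)
            (.acBox (.loop (.pc a)) (S.ac r) (S.ac q) (S.post p)))))
  | assumptionWeak (S : Args L) (a : L.ASym) (r r₁ r₂ q₁ q₂ : S.HSym) (p : S.ZSym) :
      Axm (.imp
        (.and (.acBox (.pc a) .tru
            (compCond (S.ac r) (S.ac r₁) (S.ac r₂) (S.ac q₁) (S.ac q₂)) .tru)
          (.acBox (.pc a) (.and (S.ac r₁) (S.ac r₂)) (.and (S.ac q₁) (S.ac q₂)) (S.post p)))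
        (.acBox (.pc a) (S.ac r) (.and (S.ac q₁) (S.ac q₂)) (S.post p)))
  | acDropComp (S : Args L) (a b : L.ASym) (Ya : CSet L) (za : VSet L) (r q : S.HSym)
      (p : S.ZSym) :
      Axm (.imp
        (.acBox (wfLeft S.zset a Ya za) (S.ac r) (S.ac q) (S.post p))
        (.acBox (.par (wfLeft S.zset a Ya za)
            (wfRight S.zset b (S.Y.compl.union Ya) S.zset.compl))
          (S.ac r) (S.ac q) (S.post p)))
  | gtime {n : ℕ} (x : Fin n → RVar L) (hx : Function.Injective x) (hμ : ∀ i, x i ≠ gt L)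
      (f : Fin n → L.PolSym (n + 1)) (q : L.RPredSym (n + 1))
      (p : L.PSym (Fin (n + 1)) fun _ => .real) :
      Axm (.iff
        (.box (.ode x (fun i => .fn (f i) fun j => .var (withTime x j))
            (.pred q fun j => .var (withTime x j)))
          (.pred p (CSet.empty L) fun j => .var (withTime x j)))
        (.box (.ode (Fin.cons (α := fun _ => RVar L) (gt L) x)
            (Fin.cons (α := fun _ => Poly L) (.rat 1)
              fun i => .fn (f i) fun j => .var (withTime x j))
            (.pred q fun j => .var (withTime x j)))
          (.pred p (CSet.empty L) fun j => .var (withTime x j))))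
  | send (c : L.Chan) (h h₀ : L.TName) (hh : h₀ ≠ h) (f : L.PolSym 0)
      (p : L.PSym (Fin 1) fun _ => .trace) :
      Axm (.iff (.box (.send c h (.fn f Fin.elim0)) (hist c h p))
        (.all (tv h₀)
          (.imp (.eq (s := .trace) (.var h₀)
              (.cat (.var h) (.item c (.fn f Fin.elim0) (.var (gt L)))))
            (hist c h₀ p))))
  | acCom (c : L.Chan) (h : L.TName) (f : L.PolSym 0) (r q p : L.PSym (Fin 1) fun _ => .trace) :
      Axm (.iff (.acBox (.send c h (.fn f Fin.elim0)) (hist c h r) (hist c h q) (hist c h p))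
        (.and (hist c h q) (.imp (hist c h r)
          (.box (.send c h (.fn f Fin.elim0))
            (.and (hist c h q) (.imp (hist c h r) (hist c h p)))))))
  | comDual (c : L.Chan) (h : L.TName) (x : RVar L) (hx : x ≠ gt L)
      (r q : L.PSym (Fin 1) fun _ => .trace) (p : L.PSym (Fin 2) ![.trace, .real]) :
      Axm (.iff (.acBox (.recv c h x) (hist c h r) (hist c h q) (histVal c h x p))
        (.box (.assignAny x)
          (.acBox (.send c h (.var x)) (hist c h r) (hist c h q) (histVal c h x p))))
  | acNoCom (S : Args L) (a : L.ASym) (r q : S.HSym) (p : S.ZSym) :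
      Axm (.iff (.acBox (.noCom a) (S.ac r) (S.ac q) (S.post p))
        (.and (S.ac q) (.imp (S.ac r) (.box (.noCom a) (S.post p)))))
  | acWeak (S : Args L) (a : L.ASym) (r q : S.HSym) (p : S.ZSym) :
      Axm (.iff (.acBox (.pc a) (S.ac r) (S.ac q) (S.post p))
        (.and (S.ac q) (.acBox (.pc a) (S.ac r) (S.ac q)
          (.and (S.ac q) (.imp (S.ac r) (S.post p))))))
  | acInduction (S : Args L) (a : L.ASym) (r q : S.HSym) (p : S.ZSym) :
      Axm (.iff (.acBox (.loop (.pc a)) (S.ac r) (S.ac q) (S.post p))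
        (.and (.acBox .zero (S.ac r) (S.ac q) (S.post p))
          (.acBox (.loop (.pc a)) (S.ac r) .tru
            (.imp (S.post p) (.acBox (.pc a) (S.ac r) (S.ac q) (S.post p))))))
  | acModalMP (S : Args L) (a : L.ASym) (r q₁ q₂ : S.HSym) (p₁ p₂ : S.ZSym) :
      Axm (.imp
        (.acBox (.pc a) (S.ac r) (.imp (S.ac q₁) (S.ac q₂)) (.imp (S.post p₁) (S.post p₂)))
        (.imp (.acBox (.pc a) (S.ac r) (S.ac q₁) (S.post p₁))
          (.acBox (.pc a) (S.ac r) (S.ac q₂) (S.post p₂))))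

/-- The proof rules, with the list of premises and the conclusion. -/
inductive Rule {L : Vocab} : List (Fml L) → Fml L → Prop
  | MP (φ ψ : Fml L) : Rule [.imp φ ψ, φ] ψ
  | acG (S : Args L) (a : L.ASym) (r q : S.HSym) (p : S.ZSym) :
      Rule [.and (S.ac q) (S.post p)] (.acBox (.pc a) (S.ac r) (S.ac q) (S.post p))

/-- Local soundness: in every interpretation in which all premises are true in all states, the
conclusion is true in all states. -/
def LocallySound {L : Vocab} (Γ : List (Fml L)) (φ : Fml L) : Prop :=
  ∀ I : Interp L, (∀ γ ∈ Γ, ∀ v, γ.sat I v) → ∀ v, φ.sat I v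

/-- Formulas derivable from the axioms by the rules. -/
inductive Derivable {L : Vocab} : Fml L → Prop
  | axm {φ : Fml L} (h : Axm φ) : Derivable φ
  | rule {Γ : List (Fml L)} {φ : Fml L} (h : Rule Γ φ) (hΓ : ∀ γ ∈ Γ, Derivable γ) : Derivable φ

end DLCHP

end

/-!
Each axiom is reduced to a property of the ac-box read as a predicate transformer `AcBox D A C P` on
an arbitrary set `D` of computations.

*Sequential programs.* Denotations of program constants contain the empty unfinished computation,
contain the interruption of each of their computations, keep trace variables fixed in final states,
and are independent of the recorded history (`Regular`); sequential composition and iteration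
preserve this. The formulas `A` and `C` of the axioms depend on trace variables only, on which the
initial and the final state of a computation agree. A computation of `β` after `(v, τ, u)` may
therefore start from `u`, as the semantics of `α; β` has it, or from `u · τ`, as the nested box has
it: this is `acBox_seqD`, the composition axiom. Unrolling a loop at its front (`acBox_loop`) gives
the iteration axiom, unrolling it at its end (`iterD_succ'`, by associativity of composition) gives
the induction axiom (`acBox_induction`). Weakening of assumptions (`acBox_assumptionWeak`) is an
induction along the prefixes of a trace.

*Parallel programs.* For `acBox_par_of_left`, the trace of the left program and the joint trace have
to look alike on the channels `Y`, and the two final states have to agree on `z̄`. This needs lower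
bounds on the semantic notions: a program constant writes every channel of its index set, and binds
`μ'` if its index set contains `μ'`. Both are seen in one explicit interpretation, `witness`.

*Communication and dynamics.* The boxes of single communications are computed by `acBox_event`, and
`odeD_cons_time` says that global time is part of every ODE system anyway.

Well-formedness of the axioms follows since formulas that depend on trace variables only have no
other free variables (`Fml.TraceOnly.free_subset`), and since bound variables of program constants
are among their indices (`bound_const_subset`).
-/

namespace DLCHP

open scoped Classical

variable {L : Vocab}

/-! ### States and recorded traces -/

theorem State.cat_of_ne (v : State L) (τ : RTrace L) {x : Var L} (hx : x.1 ≠ .trace) :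
    v.cat τ x = v x := by
  obtain ⟨s, x⟩ := x
  cases s <;> first | rfl | exact absurd rfl hx

theorem State.withTracesOf_of_ne (w v : State L) {x : Var L} (hx : x.1 ≠ .trace) :
    w.withTracesOf v x = w x := by
  obtain ⟨s, x⟩ := x
  cases s <;> first | rfl | exact absurd rfl hx

theorem State.proj_of_ne (v : State L) (Y : Set L.Chan) {x : Var L} (hx : x.1 ≠ .trace) :
    v.proj Y x = v x := by
  obtain ⟨s, x⟩ := x
  cases s <;> first | rfl | exact absurd rfl hx

theorem State.ext_sort {v w : State L} (ht : ∀ h, v (tv h) = w (tv h))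
    (ho : ∀ x : Var L, x.1 ≠ .trace → v x = w x) : v = w := by
  funext x
  by_cases hx : x.1 = .trace
  · obtain ⟨s, x⟩ := x
    obtain rfl : s = .trace := hx
    exact ht x
  · exact ho x hx

theorem recorded_append (h : L.TName) (τ τ' : RTrace L) :
    recorded h (τ ++ τ') = recorded h τ ++ recorded h τ' := by
  simp [recorded]

theorem State.cat_nil (v : State L) : v.cat [] = v :=
  State.ext_sort (fun h => List.append_nil (v (tv h)))
    fun _ hx => v.cat_of_ne [] hx

theorem State.cat_cat (v : State L) (τ τ' : RTrace L) : (v.cat τ).cat τ' = v.cat (τ ++ τ') := by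
  refine State.ext_sort (fun h => ?_) fun x hx => ?_
  · change (v (tv h) ++ recorded h τ) ++ recorded h τ' = v (tv h) ++ recorded h (τ ++ τ')
    rw [recorded_append, List.append_assoc]
  · rw [State.cat_of_ne _ _ hx, State.cat_of_ne _ _ hx, State.cat_of_ne _ _ hx]

theorem State.cat_tv_congr {v w : State L} (τ : RTrace L) {h : L.TName}
    (hvw : v (tv h) = w (tv h)) : v.cat τ (tv h) = w.cat τ (tv h) :=
  congrArg (fun l : List (Event L) => l ++ recorded h τ) hvw

/-- Moving recorded communication from the initial state into the trace: a final state whose trace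
variables are those of `u` reaches the same state after `τ ++ τ'` as one whose trace variables are
those of `u · τ` reaches after `τ'`. -/
theorem State.withTracesOf_cat_append {u z : State L} {τ τ' : RTrace L}
    (hz : ∀ h, z (tv h) = u.cat τ (tv h)) :
    (z.withTracesOf u).cat (τ ++ τ') = z.cat τ' := by
  refine State.ext_sort (fun h => ?_) fun x hx => ?_
  · rw [← State.cat_cat]
    exact State.cat_tv_congr _ (hz h).symm
  · rw [State.cat_of_ne _ _ hx, State.cat_of_ne _ _ hx, State.withTracesOf_of_ne _ _ hx]

/-- In the direction opposite to `State.withTracesOf_cat_append`, recorded communication moves from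
the trace into the initial state. -/
theorem State.withTracesOf_cat {u z : State L} {τ τ' : RTrace L}
    (hz : ∀ h, z (tv h) = u (tv h)) :
    (z.withTracesOf (u.cat τ)).cat τ' = z.cat (τ ++ τ') := by
  refine State.ext_sort (fun h => ?_) fun x hx => ?_
  · rw [← State.cat_cat]
    exact State.cat_tv_congr _ (State.cat_tv_congr τ (hz h)).symm
  · rw [State.cat_of_ne _ _ hx, State.cat_of_ne _ _ hx, State.withTracesOf_of_ne _ _ hx]

/-! ### Ac-boxes of regular denotations -/

/-- The ac-box as a predicate transformer, for an arbitrary set of computations. -/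
def AcBox (D : Set (Comp L)) (A C P : State L → Prop) (v : State L) : Prop :=
  ∀ τ w, (v, τ, w) ∈ D →
    ((∀ τ', τ' <+: τ → τ' ≠ τ → A (v.cat τ')) → C (v.cat τ)) ∧
    (∀ u, w = some u → (∀ τ', τ' <+: τ → A (v.cat τ')) → P (u.cat τ))

theorem sat_acBox (I : Interp L) (α : Prog L) (A C ψ : Fml L) (v : State L) :
    (Fml.acBox α A C ψ).sat I v ↔
      AcBox (α.sem I) (A.sat I) (C.sat I) (ψ.sat I) v := Iff.rfl

/-- Predicates on states that depend on trace variables only. -/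
def TraceOnly (A : State L → Prop) : Prop :=
  ∀ v v' : State L, (∀ h, v (tv h) = v' (tv h)) → (A v ↔ A v')

theorem TraceOnly.cat {A : State L → Prop} (hA : TraceOnly A) {v v' : State L}
    (h : ∀ h, v (tv h) = v' (tv h)) (τ : RTrace L) : A (v.cat τ) ↔ A (v'.cat τ) :=
  hA _ _ fun k => State.cat_tv_congr τ (h k)

/-- The closure properties of program denotations on which the sequential ac-axioms rest. -/
structure Regular (D : Set (Comp L)) : Prop where
  total : ∀ v, (v, [], none) ∈ D
  abort : ∀ v τ w, (v, τ, w) ∈ D → (v, τ, none) ∈ D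
  traces : ∀ v τ w, (v, τ, some w) ∈ D → ∀ h, w (tv h) = v (tv h)
  history : HistoryIndependent D

theorem Regular.prog (I : Interp L) (a : L.ASym) (Y : CSet L) (Z : VSet L) :
    Regular (I.prog a Y Z) where
  total _ := I.prog_total a Y Z ⟨rfl, rfl⟩
  abort v τ w h := I.prog_prefixClosed a Y Z v (τ, w) (τ, none) h
    (Or.inl ⟨rfl, List.prefix_rfl⟩)
  traces v τ w h := (I.prog_binds a Y Z v τ w h).1
  history := I.prog_history a Y Z

theorem mem_seqD {D E : Set (Comp L)} {v : State L} {τ : RTrace L} {w : Option (State L)} :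
    (v, τ, w) ∈ seqD D E ↔ (w = none ∧ ∃ w', (v, τ, w') ∈ D) ∨
      ∃ τ₁ τ₂ u, τ = τ₁ ++ τ₂ ∧ (v, τ₁, some u) ∈ D ∧ (u, τ₂, w) ∈ E := by
  refine or_congr ⟨fun ⟨w', h, hw⟩ => ⟨hw, w', h⟩, fun ⟨hw, w', h⟩ => ⟨w', h, hw⟩⟩
    ⟨fun ⟨τ₁, u, τ₂, h₁, h₂, h⟩ => ⟨τ₁, τ₂, u, h, h₁, h₂⟩,
      fun ⟨τ₁, τ₂, u, h, h₁, h₂⟩ => ⟨τ₁, u, τ₂, h₁, h₂, h⟩⟩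

theorem mem_testD {P : State L → Prop} {v : State L} {τ : RTrace L} {w : Option (State L)} :
    (v, τ, w) ∈ testD P ↔ τ = [] ∧ (w = none ∨ w = some v ∧ P v) :=
  and_or_left.symm

theorem Regular.testTrue : Regular (testD fun _ : State L => True) where
  total _ := mem_testD.2 ⟨rfl, Or.inl rfl⟩
  abort v τ w h := mem_testD.2 ⟨(mem_testD.1 h).1, Or.inl rfl⟩
  traces v τ w h := by
    obtain ⟨-, h | ⟨h, -⟩⟩ := mem_testD.1 h
    · cases h
    · cases h; exact fun _ => rfl
  history v _ τ w hv h := by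
    obtain ⟨rfl, rfl | ⟨rfl, -⟩⟩ := mem_testD.1 h
    · exact mem_testD.2 ⟨rfl, Or.inl rfl⟩
    · refine mem_testD.2 ⟨rfl, Or.inr ⟨congrArg some ?_, trivial⟩⟩
      exact State.ext_sort (fun _ => rfl) fun x hx =>
        (State.withTracesOf_of_ne _ _ hx).trans (hv x hx)

theorem Regular.seq {D E : Set (Comp L)} (hD : Regular D) (hE : Regular E) :
    Regular (seqD D E) where
  total v := mem_seqD.2 (Or.inl ⟨rfl, none, hD.total v⟩)
  abort v τ w h := by
    obtain ⟨rfl, -⟩ | ⟨τ₁, τ₂, u, rfl, h₁, h₂⟩ := mem_seqD.1 h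
    · exact h
    · exact mem_seqD.2 (Or.inr ⟨τ₁, τ₂, u, rfl, h₁, hE.abort _ _ _ h₂⟩)
  traces v τ w h := by
    obtain ⟨h, -⟩ | ⟨τ₁, τ₂, u, rfl, h₁, h₂⟩ := mem_seqD.1 h
    · cases h
    · exact fun k => (hE.traces _ _ _ h₂ k).trans (hD.traces _ _ _ h₁ k)
  history v v' τ w hv h := by
    obtain ⟨rfl, w', h⟩ | ⟨τ₁, τ₂, u, rfl, h₁, h₂⟩ := mem_seqD.1 h
    · exact mem_seqD.2 (Or.inl ⟨rfl, _, hD.history _ _ _ _ hv h⟩)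
    · refine mem_seqD.2 (Or.inr ⟨τ₁, τ₂, u.withTracesOf v', rfl,
        hD.history _ _ _ _ hv h₁, ?_⟩)
      have := hE.history u (u.withTracesOf v') τ₂ w
        (fun x hx => (State.withTracesOf_of_ne _ _ hx).symm) h₂
      convert this using 3
      cases w with
      | none => rfl
      | some w =>
        refine congrArg some (State.ext_sort (fun _ => rfl) fun x hx => ?_)
        exact (State.withTracesOf_of_ne _ _ hx).trans (State.withTracesOf_of_ne _ _ hx).symm

theorem Regular.iter {D : Set (Comp L)} (hD : Regular D) : ∀ n, Regular (iterD D n)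
  | 0 => Regular.testTrue
  | n + 1 => hD.seq (Regular.iter hD n)

theorem seqD_assoc (D E F : Set (Comp L)) : seqD (seqD D E) F = seqD D (seqD E F) := by
  ext ⟨v, τ, w⟩
  constructor
  · intro H
    obtain ⟨rfl, w', h⟩ | ⟨τ₁, τ₂, u, rfl, h, h'⟩ := mem_seqD.1 H
    · obtain ⟨-, w'', h⟩ | ⟨σ₁, σ₂, z, rfl, h₁, h₂⟩ := mem_seqD.1 h
      · exact mem_seqD.2 (Or.inl ⟨rfl, w'', h⟩)
      · exact mem_seqD.2 (Or.inr ⟨σ₁, σ₂, z, rfl, h₁, mem_seqD.2 (Or.inl ⟨rfl, _, h₂⟩)⟩)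
    · obtain ⟨h, -⟩ | ⟨σ₁, σ₂, z, rfl, h₁, h₂⟩ := mem_seqD.1 h
      · cases h
      · exact mem_seqD.2 (Or.inr ⟨σ₁, σ₂ ++ τ₂, z, List.append_assoc _ _ _, h₁,
          mem_seqD.2 (Or.inr ⟨σ₂, τ₂, u, rfl, h₂, h'⟩)⟩)
  · intro H
    obtain ⟨rfl, w', h⟩ | ⟨τ₁, τ₂, u, rfl, h, h'⟩ := mem_seqD.1 H
    · exact mem_seqD.2 (Or.inl ⟨rfl, none, mem_seqD.2 (Or.inl ⟨rfl, w', h⟩)⟩)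
    · obtain ⟨rfl, w', h'⟩ | ⟨σ₁, σ₂, z, rfl, h₁, h₂⟩ := mem_seqD.1 h'
      · exact mem_seqD.2 (Or.inl ⟨rfl, w', mem_seqD.2 (Or.inr ⟨τ₁, τ₂, u, rfl, h, h'⟩)⟩)
      · exact mem_seqD.2 (Or.inr ⟨τ₁ ++ σ₁, σ₂, z, (List.append_assoc _ _ _).symm,
          mem_seqD.2 (Or.inr ⟨τ₁, σ₁, u, rfl, h, h₁⟩), h₂⟩)

theorem seqD_testTrue {D : Set (Comp L)} (hD : Regular D) :
    seqD D (testD fun _ => True) = D := by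
  ext ⟨v, τ, w⟩
  constructor
  · intro H
    obtain ⟨rfl, w', h⟩ | ⟨τ₁, τ₂, u, rfl, h, h'⟩ := mem_seqD.1 H
    · exact hD.abort _ _ _ h
    · obtain ⟨rfl, rfl | ⟨rfl, -⟩⟩ := mem_testD.1 h' <;> rw [List.append_nil]
      · exact hD.abort _ _ _ h
      · exact h
  · intro h
    cases w with
    | none => exact mem_seqD.2 (Or.inl ⟨rfl, none, h⟩)
    | some u =>
      exact mem_seqD.2 (Or.inr ⟨τ, [], u, (List.append_nil τ).symm, h,
        mem_testD.2 ⟨rfl, Or.inr ⟨rfl, trivial⟩⟩⟩)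

theorem testTrue_seqD {D : Set (Comp L)} (hD : Regular D) :
    seqD (testD fun _ => True) D = D := by
  ext ⟨v, τ, w⟩
  constructor
  · intro H
    obtain ⟨rfl, w', h⟩ | ⟨τ₁, τ₂, u, rfl, h, h'⟩ := mem_seqD.1 H
    · obtain ⟨rfl, -⟩ := mem_testD.1 h
      exact hD.total v
    · obtain ⟨rfl, h | ⟨h, -⟩⟩ := mem_testD.1 h <;> cases h
      exact h'
  · exact fun h => mem_seqD.2 (Or.inr ⟨[], τ, v, rfl,
      mem_testD.2 ⟨rfl, Or.inr ⟨rfl, trivial⟩⟩, h⟩)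

/-- Unrolling the last iteration instead of the first. -/
theorem iterD_succ' {D : Set (Comp L)} (hD : Regular D) (n : ℕ) :
    iterD D (n + 1) = seqD (iterD D n) D := by
  induction n with
  | zero => exact (seqD_testTrue hD).trans (testTrue_seqD hD).symm
  | succ n ih =>
    calc seqD D (iterD D (n + 1)) = seqD D (seqD (iterD D n) D) := by rw [ih]
      _ = seqD (iterD D (n + 1)) D := (seqD_assoc _ _ _).symm

/-! ### Composition, iteration, and weakening -/

theorem prefix_append_cases {X : Type*} {l l₁ l₂ : List X} (h : l <+: l₁ ++ l₂) :
    l <+: l₁ ∨ ∃ l', l = l₁ ++ l' ∧ l' <+: l₂ := by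
  rcases List.prefix_or_prefix_of_prefix h (List.prefix_append l₁ l₂) with h' | ⟨l', rfl⟩
  · exact Or.inl h'
  · exact Or.inr ⟨l', rfl, (List.prefix_append_right_inj l₁).1 h⟩

/-- Ac-boxes of sequential compositions are nested ac-boxes.  History independence lets the second
program start either from the intermediate state `u` or from `u · τ`. -/
theorem acBox_seqD {D E : Set (Comp L)} (hD : Regular D) (hE : Regular E)
    {A C : State L → Prop} (hA : TraceOnly A) (hC : TraceOnly C) (P : State L → Prop)
    (v : State L) : AcBox (seqD D E) A C P v ↔ AcBox D A C (AcBox E A C P) v := by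
  constructor
  · intro H τ w hτ
    refine ⟨(H τ none (mem_seqD.2 (Or.inl ⟨rfl, w, hτ⟩))).1, ?_⟩
    rintro u rfl hAτ τ₂ w₂ h₂
    have huv := hD.traces _ _ _ hτ
    have h₂' := hE.history _ u _ _ (fun x hx => State.cat_of_ne _ _ hx) h₂
    obtain ⟨H₁, H₂⟩ := H (τ ++ τ₂) _
      (mem_seqD.2 (Or.inr ⟨τ, τ₂, u, rfl, hτ, h₂'⟩))
    constructor
    · intro hA₂
      rw [State.cat_cat, hC.cat huv]
      refine H₁ fun τ' h hne => ?_
      obtain h' | ⟨σ, rfl, h'⟩ := prefix_append_cases h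
      · exact hAτ τ' h'
      · rw [← hA.cat huv, ← State.cat_cat]
        exact hA₂ σ h' fun e => hne (by rw [e])
    · rintro z rfl hA₂
      have := H₂ _ rfl fun τ' h => ?_
      · rwa [State.withTracesOf_cat_append (hE.traces _ _ _ h₂)] at this
      · obtain h' | ⟨σ, rfl, h'⟩ := prefix_append_cases h
        · exact hAτ τ' h'
        · rw [← hA.cat huv, ← State.cat_cat]
          exact hA₂ σ h'
  · intro H τ w hτ
    obtain ⟨rfl, w', h⟩ | ⟨τ₁, τ₂, u, rfl, h₁, h₂⟩ := mem_seqD.1 hτ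
    · exact ⟨(H τ w' h).1, fun _ h => by cases h⟩
    · have huv := hD.traces _ _ _ h₁
      have h₂' := hE.history _ (u.cat τ₁) _ _ (fun x hx => (State.cat_of_ne _ _ hx).symm) h₂
      obtain ⟨H₁, H₂⟩ := H _ _ h₁
      constructor
      · intro hA'
        -- If `E` has not communicated, `A` is assumed at strict prefixes of `τ₁` only, so that the
        -- commitment has to come from `D` alone; otherwise `D` delivers its postcondition.
        by_cases hnil : τ₂ = []
        · subst hnil
          rw [List.append_nil] at hA' ⊢
          exact H₁ hA'
        · have hAτ : ∀ τ', τ' <+: τ₁ → A (v.cat τ') := fun τ' h => by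
            refine hA' τ' (h.trans (List.prefix_append _ _)) ?_
            rintro rfl
            have := h.length_le
            simp only [List.length_append] at this
            exact hnil (List.length_eq_zero_iff.1 (by omega))
          rw [← hC.cat huv, ← State.cat_cat]
          refine (H₂ u rfl hAτ _ _ h₂').1 fun σ h hne => ?_
          rw [State.cat_cat, hA.cat huv]
          exact hA' _ ((List.prefix_append_right_inj τ₁).2 h)
            fun e => hne (List.append_cancel_left e)
      · rintro z rfl hA'
        have := (H₂ u rfl (fun τ' h => hA' τ' (h.trans (List.prefix_append _ _))) _ _ h₂').2
          _ rfl fun σ h => ?_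
        · rwa [State.withTracesOf_cat (hE.traces _ _ _ h₂)] at this
        · rw [State.cat_cat, hA.cat huv]
          exact hA' _ ((List.prefix_append_right_inj τ₁).2 h)

theorem acBox_iUnion {ι : Type*} (D : ι → Set (Comp L)) (A C P : State L → Prop) (v : State L) :
    AcBox (⋃ n, D n) A C P v ↔ ∀ n, AcBox (D n) A C P v := by
  simp only [AcBox, Set.mem_iUnion]
  exact ⟨fun H n τ w h => H τ w ⟨n, h⟩, fun H τ w ⟨n, h⟩ => H n τ w h⟩

theorem acBox_forall {ι : Type*} [Nonempty ι] (D : Set (Comp L)) (A C : State L → Prop)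
    (P : ι → State L → Prop) (v : State L) :
    AcBox D A C (fun u => ∀ n, P n u) v ↔ ∀ n, AcBox D A C (P n) v := by
  refine ⟨fun H n τ w h => ⟨(H τ w h).1, fun u hu hA => (H τ w h).2 u hu hA n⟩,
    fun H τ w h => ⟨(H (Classical.arbitrary ι) τ w h).1, fun u hu hA n => (H n τ w h).2 u hu hA⟩⟩

theorem AcBox.mp {D : Set (Comp L)} {A C₁ C₂ P₁ P₂ : State L → Prop} {v : State L}
    (H : AcBox D A (fun u => C₁ u → C₂ u) (fun u => P₁ u → P₂ u) v) (H₁ : AcBox D A C₁ P₁ v) :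
    AcBox D A C₂ P₂ v := fun τ w h =>
  ⟨fun hA => (H τ w h).1 hA ((H₁ τ w h).1 hA),
    fun u hu hA => (H τ w h).2 u hu hA ((H₁ τ w h).2 u hu hA)⟩

theorem AcBox.mono {D : Set (Comp L)} {A C₁ C₂ P₁ P₂ : State L → Prop} {v : State L}
    (H₁ : AcBox D A C₁ P₁ v) (hC : ∀ u, C₁ u → C₂ u) (hP : ∀ u, P₁ u → P₂ u) :
    AcBox D A C₂ P₂ v :=
  AcBox.mp (fun _ _ _ => ⟨fun _ => hC _, fun _ _ _ => hP _⟩) H₁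

theorem acBox_loop {D : Set (Comp L)} (hD : Regular D) {A C : State L → Prop}
    (hA : TraceOnly A) (hC : TraceOnly C) (P : State L → Prop) (v : State L) :
    AcBox (⋃ n, iterD D n) A C P v ↔
      AcBox (iterD D 0) A C P v ∧ AcBox D A C (AcBox (⋃ n, iterD D n) A C P) v := by
  have h (n : ℕ) := acBox_seqD hD (hD.iter n) hA hC P v
  simp only [acBox_iUnion, acBox_forall,
    show AcBox (⋃ n, iterD D n) A C P = fun u => ∀ n, AcBox (iterD D n) A C P u from
      funext fun u => propext (acBox_iUnion _ _ _ _ u), ← h]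
  exact ⟨fun H => ⟨H 0, fun n => H (n + 1)⟩, fun H n => match n with
    | 0 => H.1
    | n + 1 => H.2 n⟩

/-- The loop is unrolled at its end, so that each further iteration starts where the postcondition
is known to hold by induction. -/
theorem acBox_induction {D : Set (Comp L)} (hD : Regular D) {A C : State L → Prop}
    (hA : TraceOnly A) (hC : TraceOnly C) (P : State L → Prop) (v : State L) :
    AcBox (⋃ n, iterD D n) A C P v ↔
      AcBox (iterD D 0) A C P v ∧
        AcBox (⋃ n, iterD D n) A (fun _ => True) (fun u => P u → AcBox D A C P u) v := by
  have h (n : ℕ) : AcBox (iterD D (n + 1)) A C P v ↔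
      AcBox (iterD D n) A C (AcBox D A C P) v := by
    rw [iterD_succ' hD]; exact acBox_seqD (hD.iter n) hD hA hC P v
  simp only [acBox_iUnion]
  refine ⟨fun H => ⟨H 0, fun n => ((h n).1 (H (n + 1))).mono (fun _ _ => trivial)
    fun _ h _ => h⟩, fun H n => ?_⟩
  induction n with
  | zero => exact H.1
  | succ n ih =>
    refine (h n).2 (AcBox.mp (C₁ := C) (P₁ := P) ?_ ih)
    exact (H.2 n).mono (fun _ _ => id) fun _ => id

/-- Assumptions may be weakened if the commitments reestablish them: along every prefix the
commitments follow by induction on the length of the prefix. -/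
theorem acBox_assumptionWeak {D : Set (Comp L)} (hD : PrefixClosed D)
    {A B C P : State L → Prop} {v : State L}
    (hK : AcBox D (fun _ => True) (fun u => A u → C u → B u) (fun _ => True) v)
    (H : AcBox D B C P v) : AcBox D A C P v := by
  intro τ w hτ
  have hpre : ∀ τ', τ' <+: τ → (v, τ', none) ∈ D := fun τ' h =>
    hD v (τ, w) (τ', none) hτ (Or.inl ⟨rfl, h⟩)
  have hK' : ∀ τ', τ' <+: τ → A (v.cat τ') → C (v.cat τ') → B (v.cat τ') := fun τ' h =>
    (hK τ' none (hpre τ' h)).1 fun _ _ _ => trivial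
  have key : ∀ n τ', τ'.length = n → τ' <+: τ →
      (∀ σ, σ <+: τ' → σ ≠ τ' → A (v.cat σ)) → C (v.cat τ') := by
    intro n
    induction n using Nat.strong_induction_on with
    | _ n ih =>
      rintro τ' rfl hτ' hA
      refine (H τ' none (hpre τ' hτ')).1 fun σ hσ hne => ?_
      refine hK' σ (hσ.trans hτ') (hA σ hσ hne) ?_
      refine ih _ (lt_of_le_of_ne hσ.length_le fun e => hne (hσ.eq_of_length e)) σ rfl
        (hσ.trans hτ') fun ρ hρ _ => hA ρ (hρ.trans hσ) ?_
      rintro rfl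
      exact hne (hσ.eq_of_length (le_antisymm hσ.length_le hρ.length_le))
  refine ⟨fun hA => key _ τ rfl List.prefix_rfl hA, fun u hu hA => ?_⟩
  exact (H τ w hτ).2 u hu fun σ hσ =>
    hK' σ hσ (hA σ hσ) (key _ σ rfl hσ fun ρ hρ _ => hA ρ (hρ.trans hσ))

/-- The commitment holds initially by the empty unfinished computation; at the end of a run,
assumption and commitment agree in the final state and in the initial one extended by the trace. -/
theorem acBox_weak {D : Set (Comp L)} (hD : Regular D) {A C : State L → Prop}
    (hA : TraceOnly A) (hC : TraceOnly C) (P : State L → Prop) (v : State L) :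
    AcBox D A C P v ↔ C v ∧ AcBox D A C (fun u => C u ∧ (A u → P u)) v := by
  refine ⟨fun H => ⟨?_, fun τ w hτ => ⟨(H τ w hτ).1, ?_⟩⟩,
    fun ⟨_, H⟩ τ w hτ => ⟨(H τ w hτ).1, ?_⟩⟩
  · have := (H [] none (hD.total v)).1 fun τ' h hne => absurd (List.prefix_nil.1 h) hne
    rwa [State.cat_nil] at this
  · rintro u rfl hAτ
    refine ⟨?_, fun _ => (H τ _ hτ).2 u rfl hAτ⟩
    rw [hC.cat (hD.traces _ _ _ hτ)]
    exact (H τ _ hτ).1 fun τ' h _ => hAτ τ' h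
  · rintro u rfl hAτ
    refine ((H τ _ hτ).2 u rfl hAτ).2 ?_
    rw [hA.cat (hD.traces _ _ _ hτ)]
    exact hAτ τ List.prefix_rfl


/-! ### Satisfaction and formulas over traces -/

theorem sat_imp (I : Interp L) (φ ψ : Fml L) (v : State L) :
    (φ.imp ψ).sat I v ↔ (φ.sat I v → ψ.sat I v) := by
  simp only [Fml.imp, Fml.sat, not_and, not_not]

theorem sat_and (I : Interp L) (φ ψ : Fml L) (v : State L) :
    (Fml.and φ ψ).sat I v ↔ φ.sat I v ∧ ψ.sat I v := Iff.rfl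

theorem sat_iff (I : Interp L) (φ ψ : Fml L) (v : State L) :
    (φ.iff ψ).sat I v ↔ (φ.sat I v ↔ ψ.sat I v) := by
  rw [Fml.iff, sat_and, sat_imp, sat_imp]
  exact iff_iff_implies_and_implies.symm

theorem sat_tru (I : Interp L) (v : State L) : Fml.tru.sat I v ↔ True :=
  iff_of_true rfl trivial

theorem sat_imp_eq (I : Interp L) (φ ψ : Fml L) :
    (φ.imp ψ).sat I = fun v => φ.sat I v → ψ.sat I v :=
  funext fun v => propext (sat_imp I φ ψ v)

theorem sat_tru_eq (I : Interp L) : (Fml.tru : Fml L).sat I = fun _ => True :=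
  funext fun v => propext (sat_tru I v)

theorem sem_zero (I : Interp L) : (Prog.zero : Prog L).sem I = testD fun _ => True := by
  have : (fun v : State L => RFml.tru.sat I v) = fun _ => True :=
    funext fun _ => eq_true rfl
  exact congrArg testD this

/-- Formulas whose truth depends on trace variables only. -/
def Fml.TraceOnly (φ : Fml L) : Prop := ∀ I, DLCHP.TraceOnly (φ.sat I)

theorem Fml.TraceOnly.free_subset {φ : Fml L} (hφ : φ.TraceOnly) :
    φ.free ⊆ {x | x.1 = .trace} := by
  rintro x ⟨I, v, v', hv, h⟩
  by_contra hx
  refine h (hφ I v v' fun k => hv _ ?_)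
  rintro rfl
  exact hx rfl

theorem Fml.TraceOnly.neg {φ : Fml L} (hφ : φ.TraceOnly) : (Fml.neg φ).TraceOnly :=
  fun I v v' h => not_congr (hφ I v v' h)

theorem Fml.TraceOnly.and {φ ψ : Fml L} (hφ : φ.TraceOnly) (hψ : ψ.TraceOnly) :
    (Fml.and φ ψ).TraceOnly :=
  fun I v v' h => and_congr (hφ I v v' h) (hψ I v v' h)

theorem Fml.TraceOnly.imp {φ ψ : Fml L} (hφ : φ.TraceOnly) (hψ : ψ.TraceOnly) :
    (Fml.imp φ ψ).TraceOnly :=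
  (hφ.and hψ.neg).neg

theorem traceOnly_tru : (Fml.tru : Fml L).TraceOnly :=
  fun I v v' _ => (sat_tru I v).trans (sat_tru I v').symm

theorem sat_ac_congr (I : Interp L) (S : Args L) (r : S.HSym) {v v' : State L}
    (h : ∀ h, v.proj S.Y.1 (tv h) = v'.proj S.Y.1 (tv h)) :
    (S.ac r).sat I v ↔ (S.ac r).sat I v' :=
  iff_of_eq (congrArg (· ∈ I.pred r) (funext fun i => h (S.h i)))

theorem proj_tv_congr {v v' : State L} (Y : Set L.Chan) {h : L.TName}
    (hv : v (tv h) = v' (tv h)) : v.proj Y (tv h) = v'.proj Y (tv h) :=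
  congrArg (projT Y) hv

theorem traceOnly_ac (S : Args L) (r : S.HSym) : (S.ac r).TraceOnly :=
  fun I _ _ h => sat_ac_congr I S r fun k => proj_tv_congr _ (h k)

theorem hist_congr (I : Interp L) (c : L.Chan) (h : L.TName)
    (p : L.PSym (Fin 1) fun _ => .trace) {v v' : State L} (hv : v (tv h) = v' (tv h)) :
    (hist c h p).sat I v ↔ (hist c h p).sat I v' :=
  iff_of_eq (congrArg (· ∈ I.pred p) (funext fun _ => proj_tv_congr _ hv))

theorem traceOnly_hist (c : L.Chan) (h : L.TName) (p : L.PSym (Fin 1) fun _ => .trace) :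
    (hist c h p).TraceOnly :=
  fun I _ _ hv => hist_congr I c h p (hv h)

theorem wf_acBox {α : Prog L} {A C ψ : Fml L} (hα : α.WF) (hA : A.WF) (hC : C.WF) (hψ : ψ.WF)
    (hA' : A.TraceOnly) (hC' : C.TraceOnly) : (Fml.acBox α A C ψ).WF :=
  ⟨hα, hA, hC, hψ, fun _ hx => (Set.union_subset hA'.free_subset hC'.free_subset) hx.1⟩

theorem wf_imp {φ ψ : Fml L} : (φ.imp ψ).WF ↔ φ.WF ∧ ψ.WF := Iff.rfl

theorem wf_iff {φ ψ : Fml L} : (φ.iff ψ).WF ↔ φ.WF ∧ ψ.WF :=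
  ⟨And.left, fun h => ⟨h, h.symm⟩⟩

/-! ### Written channels and bound variables of program constants -/

/-- An arbitrary value of each sort. -/
def defaultVal (L : Vocab) : (s : Srt) → Val L s
  | .real => (0 : ℝ)
  | .int => (0 : ℕ)
  | .chan => L.chan0
  | .trace => ([] : List (Event L))

/-- The computations of the program constants of `witness`: besides unfinished ones, of at most one
event on a channel of `Y`, those that increase `μ'` by one, if `μ'` is in `Z`. -/
def witnessD (Y : CSet L) (Z : VSet L) : Set (Comp L) :=
  {c | (c.2.2 = none ∧
      (c.2.1 = [] ∨ ∃ e : REvent L, c.2.1 = [e] ∧ e.ch ∈ Y.1 ∧ e.time = c.1.now)) ∨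
    (rv (gt L).prime ∈ Z.1 ∧ c.2.1 = [] ∧
      c.2.2 = some (c.1.set (rv (gt L).prime) (c.1 (rv (gt L).prime) + (1 : ℝ))))}

theorem mem_witnessD {Y : CSet L} {Z : VSet L} {v : State L} {τ : RTrace L}
    {w : Option (State L)} : (v, τ, w) ∈ witnessD Y Z ↔
      (w = none ∧ (τ = [] ∨ ∃ e : REvent L, τ = [e] ∧ e.ch ∈ Y.1 ∧ e.time = v.now)) ∨
      (rv (gt L).prime ∈ Z.1 ∧ τ = [] ∧
        w = some (v.set (rv (gt L).prime) (v (rv (gt L).prime) + (1 : ℝ)))) :=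
  Iff.rfl

theorem gt_ne_prime : gt L ≠ (gt L).prime := fun h => by
  have := congrArg Prod.snd h
  simp [gt, RVar.prime] at this

theorem rv_injective : Function.Injective (rv : RVar L → Var L) :=
  fun _ _ h => eq_of_heq (Sigma.mk.inj h).2

theorem State.set_self (v : State L) (x : Var L) (d : Val L x.1) : v.set x d x = d :=
  Function.update_self ..

theorem State.set_of_ne (v : State L) {x y : Var L} (d : Val L x.1) (h : y ≠ x) :
    v.set x d y = v y :=
  Function.update_of_ne h ..

theorem State.now_congr {v v' : State L} (h : ∀ x : Var L, x.1 ≠ .trace → v x = v' x) :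
    v.now = v'.now := h _ (by simp)

theorem now_set_prime (v : State L) (d : ℝ) : (v.set (rv (gt L).prime) d).now = v.now := by
  refine State.set_of_ne v (x := rv (gt L).prime) (y := rv (gt L)) d fun h => ?_
  exact gt_ne_prime (rv_injective h)

/-- An interpretation in which program constants write every channel, and bind `μ'`, whenever
their indices allow it. -/
def witness (L : Vocab) : Interp L where
  fn {_ _ r} _ _ := defaultVal L r
  fn_smooth _ _ := contDiff_const
  pol _ _ := 0
  pol_smooth _ := contDiff_const
  pred _ := ∅
  rpred _ := ∅
  prog _ Y Z := witnessD Y Z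
  prog_prefixClosed := by
    rintro - Y Z v o ⟨τ', w'⟩ h (⟨hw, hτ⟩ | rfl)
    · obtain rfl : w' = none := hw
      refine Or.inl ⟨rfl, ?_⟩
      obtain ⟨-, h | ⟨e, h, he⟩⟩ | ⟨-, h, -⟩ := h
      · exact Or.inl (List.prefix_nil.1 (h ▸ hτ))
      · simp only at h hτ ⊢
        rw [h, List.prefix_cons_iff] at hτ
        obtain hτ | ⟨t, rfl, ht⟩ := hτ
        · exact Or.inl hτ
        · exact Or.inr ⟨e, by rw [List.prefix_nil.1 ht], he⟩
      · exact Or.inl (List.prefix_nil.1 (h ▸ hτ))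
    · exact h
  prog_total := fun _ _ _ _ h => Or.inl ⟨h.2, Or.inl h.1⟩
  prog_chron := by
    intro _ Y Z v τ w h
    obtain ⟨rfl, rfl | ⟨e, rfl, he⟩⟩ | ⟨-, rfl, rfl⟩ := mem_witnessD.1 h
    · exact ⟨List.Pairwise.nil, by simp, by simp⟩
    · exact ⟨List.pairwise_singleton _ _, by simp [he.2], by simp⟩
    · refine ⟨List.Pairwise.nil, by simp, ?_⟩
      rintro u ⟨⟩
      exact ⟨(now_set_prime v _).ge, by simp⟩
  prog_writes := by
    intro _ Y Z v τ w h
    obtain ⟨rfl, rfl | ⟨e, rfl, he⟩⟩ | ⟨-, rfl, rfl⟩ := mem_witnessD.1 h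
    · rfl
    · simp [projR, he.1]
    · rfl
  prog_binds := by
    intro _ Y Z v τ w h
    obtain ⟨h, -⟩ | ⟨hZ, rfl, hw⟩ := mem_witnessD.1 h
    · cases h
    · cases hw
      refine ⟨fun h => State.set_of_ne _ _ (by simp), fun x hx => ?_⟩
      rw [State.cat_nil]
      exact State.set_of_ne _ _ fun e => hx (e ▸ hZ)
  prog_history := by
    intro _ Y Z v v' τ w hv h
    obtain ⟨rfl, h⟩ | ⟨hZ, rfl, rfl⟩ := mem_witnessD.1 h
    · refine mem_witnessD.2 (Or.inl ⟨rfl, ?_⟩)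
      rwa [← State.now_congr hv]
    · refine Or.inr ⟨hZ, rfl, congrArg some (State.ext_sort (fun h => ?_) fun x hx => ?_)⟩
      · exact (State.set_of_ne v' _ (by simp)).symm
      · refine (State.withTracesOf_of_ne _ _ hx).trans ?_
        by_cases hx' : x = rv (gt L).prime
        · subst hx'
          simp only [State.set_self, hv _ hx]
        · rw [State.set_of_ne _ _ hx', State.set_of_ne _ _ hx', hv x hx]

theorem projR_eq_nil {Y : Set L.Chan} {τ : RTrace L} : projR Y τ = [] ↔ ∀ e ∈ τ, e.ch ∉ Y := by
  simp [projR, List.filter_eq_nil_iff]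

theorem projR_eq_self {Y : Set L.Chan} {τ : RTrace L} : projR Y τ = τ ↔ ∀ e ∈ τ, e.ch ∈ Y := by
  simp [projR, List.filter_eq_self]

/-- A program constant writes all channels of its index that can occur in a trace: there is no
recorded event at all if there are no trace variables, hence the statement about events. -/
theorem ch_mem_written_const (a : L.ASym) (Y : CSet L) (Z : VSet L) (e : REvent L) :
    e.ch ∈ (Prog.const a Y Z).sem.written ↔ e.ch ∈ Y.1 := by
  constructor
  · rintro ⟨I, v, τ, w, h, hc⟩
    by_contra hY
    refine hc (projR_eq_nil.2 fun e' he' h' => ?_)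
    refine projR_eq_nil.1 (I.prog_writes a Y Z v τ w h) e' he' ?_
    rw [Set.mem_singleton_iff.1 h']
    exact hY
  · intro hY
    refine ⟨witness L, fun x => defaultVal L x.1, [⟨e.recorder, e.ch, 0, 0⟩], none,
      Or.inl ⟨rfl, Or.inr ⟨_, rfl, hY, rfl⟩⟩, ?_⟩
    simp [projR]

theorem bound_const_subset (a : L.ASym) (Y : CSet L) (Z : VSet L) :
    (Prog.const a Y Z).sem.bound ⊆ Z.1 := by
  rintro x ⟨I, v, τ, w, h, hx⟩
  by_contra hZ
  exact hx ((I.prog_binds a Y Z v τ w h).2 x hZ)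

/-- If the indices of a program constant allow it, `μ'` is bound. -/
theorem prime_time_mem_bound_const (a : L.ASym) (Y : CSet L) {Z : VSet L}
    (hZ : rv (gt L).prime ∈ Z.1) : rv (gt L).prime ∈ (Prog.const a Y Z).sem.bound := by
  refine ⟨witness L, fun x => defaultVal L x.1, [], _,
    mem_witnessD.2 (Or.inr ⟨hZ, rfl, rfl⟩), ?_⟩
  rw [State.cat_nil, State.set_self]
  change (0 : ℝ) + 1 ≠ 0
  norm_num

theorem proj_cat_tv (v : State L) (Y : Set L.Chan) (τ : RTrace L) (h : L.TName) :
    (v.cat τ).proj Y (tv h) = projT Y (v (tv h)) ++ recorded h (projR Y τ) := by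
  change projT Y (v (tv h) ++ recorded h τ) = _
  simp only [projT, recorded, projR, List.filter_append, List.filter_map, List.filter_filter]
  congr 3
  funext e
  exact Bool.and_comm _ _

theorem proj_cat_tv_congr {v v' : State L} {Y : Set L.Chan} {τ τ' : RTrace L} {h : L.TName}
    (hv : v (tv h) = v' (tv h)) (hτ : projR Y τ = projR Y τ') :
    (v.cat τ).proj Y (tv h) = (v'.cat τ').proj Y (tv h) := by
  rw [proj_cat_tv, proj_cat_tv, hv, hτ]

/-! ### Parallel composition -/

theorem wf_par_const (z : VSet L) (a b : L.ASym) (Ya Yb : CSet L) (za zb : VSet L) :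
    (Prog.par (wfLeft z a Ya za) (wfRight z b Yb zb)).WF := by
  refine ⟨trivial, trivial, ?_⟩
  rintro x ⟨h₁, h₂⟩
  obtain h₁ | h₁ := bound_const_subset _ _ _ h₁
  · obtain h₂ | h₂ := bound_const_subset _ _ _ h₂
    · exact absurd h₁.2 h₂.2.2
    · exact h₂
  · exact h₁

/-- The program `a` in parallel with a program that shares with `Y` only channels of `a` and with
`z` only `μ`, `μ'` and trace variables.  The part of any joint trace that is visible in `Y` is
already part of the trace of `a`, and the merged final state agrees on `z` with the final state of
`a`; for `μ'` this holds because `a` semantically binds `μ'`. -/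
theorem acBox_par_of_left (I : Interp L) (S : Args L) (a b : L.ASym) (Ya : CSet L) (za zb : VSet L)
    (r q : S.HSym) (p : S.ZSym) (v : State L)
    (H : AcBox ((wfLeft S.zset a Ya za).sem I) ((S.ac r).sat I) ((S.ac q).sat I)
      ((S.post p).sat I) v) :
    AcBox ((Prog.par (wfLeft S.zset a Ya za)
        (wfRight S.zset b (S.Y.compl.union Ya) zb)).sem I)
      ((S.ac r).sat I) ((S.ac q).sat I) ((S.post p).sat I) v := by
  rintro τ w ⟨w₁, w₂, h₁, h₂, hnow, -, hτ, hw⟩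
  simp only at h₁ h₂ hnow hτ hw
  -- A visible event of `b` is on a channel of `Ya`, and `a` writes all of these.
  have hmem : ∀ e ∈ τ, e.ch ∈ S.Y.1 → e.ch ∈ (wfLeft S.zset a Ya za).sem.written := by
    intro e he hY
    obtain h | h := projR_eq_self.1 hτ e he
    · exact h
    · obtain h | h := (ch_mem_written_const _ _ _ e).1 h
      · exact absurd hY h
      · exact (ch_mem_written_const _ _ _ e).2 h
  have hproj : ∀ τ', τ' <+: τ →
      projR S.Y.1 (projR (wfLeft S.zset a Ya za).sem.written τ') = projR S.Y.1 τ' := by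
    intro τ' hτ'
    rw [projR, projR, List.filter_filter]
    refine List.filter_congr fun e he => ?_
    have := hmem e (hτ'.subset he)
    simpa using this
  have hac (r' : S.HSym) (τ') (h : τ' <+: τ) : (S.ac r').sat I (v.cat τ') ↔
      (S.ac r').sat I (v.cat (projR (wfLeft S.zset a Ya za).sem.written τ')) :=
    sat_ac_congr I S r' fun k => proj_cat_tv_congr rfl (hproj τ' h).symm
  obtain ⟨H₁, H₂⟩ := H _ _ h₁
  refine ⟨fun hA => (hac q τ List.prefix_rfl).2 (H₁ fun σ hσ hne => ?_), ?_⟩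
  · obtain ⟨τ', h, rfl⟩ := List.prefix_filter_iff.1 hσ
    exact (hac r τ' h).1 (hA τ' h fun e => hne (by rw [e]; rfl))
  · rintro u rfl hA
    match w₁, w₂, hw with
    | some u₁, some u₂, hw =>
    obtain rfl := Option.some.inj hw
    have hb₁ := I.prog_binds _ _ _ _ _ _ h₁
    have hb₂ := I.prog_binds _ _ _ _ _ _ h₂
    have hpost := H₂ u₁ rfl fun σ hσ => by
      obtain ⟨τ', h, rfl⟩ := List.prefix_filter_iff.1 hσ
      exact (hac r τ' h).1 (hA τ' h)
    refine (iff_of_eq (congrArg (· ∈ I.pred p) (funext fun i => ?_))).1 hpost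
    have hz : (⟨S.s i, S.z i⟩ : Var L) ∈ S.zset.1 := S.range_z ▸ Set.mem_range_self i
    change State.proj _ _ (⟨S.s i, S.z i⟩ : Var L) = State.proj _ _ (⟨S.s i, S.z i⟩ : Var L)
    generalize (⟨S.s i, S.z i⟩ : Var L) = x at hz ⊢
    by_cases hx : x.1 = .trace
    · obtain ⟨s, x⟩ := x
      obtain rfl : s = .trace := hx
      refine proj_cat_tv_congr ?_ (hproj τ List.prefix_rfl)
      split_ifs
      · rfl
      · exact (hb₁.1 x).trans (hb₂.1 x).symm
    · rw [State.proj_of_ne _ _ hx, State.proj_of_ne _ _ hx, State.cat_of_ne _ _ hx,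
        State.cat_of_ne _ _ hx]
      split_ifs with hB
      · rfl
      by_cases hs : x ∈ (shared L).1
      · obtain hs | hs | hs := hs
        · exact absurd hs hx
        · obtain rfl := Set.mem_singleton_iff.1 hs
          exact Option.some.inj hnow
        · obtain rfl := Set.mem_singleton_iff.1 hs
          exact absurd (prime_time_mem_bound_const a Ya (Z := (za.inter S.zset).union (shared L))
            (Or.inr (Or.inr (Or.inr rfl)))) hB
      -- A variable of `z̄` that is not shared cannot be bound by `b`; bound by neither program, it
      -- keeps its initial value.
      · have e₁ : u₁ x = v x := by
          by_contra hne
          exact hB ⟨I, v, _, u₁, h₁, by rwa [State.cat_of_ne _ _ hx]⟩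
        have e₂ := hb₂.2 x (by
          rintro (h | h)
          · exact h.2.2 hz
          · exact hs h)
        rw [State.cat_of_ne _ _ hx] at e₂
        rw [e₁, e₂]


/-! ### Boxes of atomic programs -/

theorem sat_box_assign (I : Interp L) (x : RVar L) (θ : Poly L) (ψ : Fml L) (v : State L) :
    (Fml.box (.assign x θ) ψ).sat I v ↔ ψ.sat I (v.set (rv x) (θ.eval I v)) := by
  have mem (τ : RTrace L) (w : State L) : (v, τ, some w) ∈ (Prog.assign x θ).sem I ↔
      (τ = [] ∧ some w = none) ∨ (τ = [] ∧ some w = some (v.set (rv x) (θ.eval I v))) := Iff.rfl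
  constructor
  · intro H
    have := H [] _ ((mem _ _).2 (Or.inr ⟨rfl, rfl⟩))
    rwa [State.cat_nil] at this
  · intro H τ w hw
    obtain ⟨-, h⟩ | ⟨rfl, h⟩ := (mem _ _).1 hw <;> cases h
    rwa [State.cat_nil]

theorem sat_box_assignAny (I : Interp L) (x : RVar L) (ψ : Fml L) (v : State L) :
    (Fml.box (.assignAny x) ψ).sat I v ↔ ∀ d : ℝ, ψ.sat I (v.set (rv x) d) := by
  have mem (τ : RTrace L) (w : State L) : (v, τ, some w) ∈ (Prog.assignAny x).sem I ↔
      (τ = [] ∧ some w = none) ∨ (τ = [] ∧ ∃ d : ℝ, some w = some (v.set (rv x) d)) := Iff.rfl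
  constructor
  · intro H d
    have := H [] _ ((mem _ _).2 (Or.inr ⟨rfl, d, rfl⟩))
    rwa [State.cat_nil] at this
  · intro H τ w hw
    obtain ⟨-, h⟩ | ⟨rfl, d, h⟩ := (mem _ _).1 hw <;> cases h
    rw [State.cat_nil]
    exact H d

theorem sat_box_test (I : Interp L) (χ : RFml L) (ψ : Fml L) (v : State L) :
    (Fml.box (.test χ) ψ).sat I v ↔ (χ.sat I v → ψ.sat I v) := by
  constructor
  · intro H hχ
    have := H [] v (mem_testD.2 ⟨rfl, Or.inr ⟨rfl, hχ⟩⟩)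
    rwa [State.cat_nil] at this
  · intro H τ w hw
    obtain ⟨rfl, h | ⟨h, hχ⟩⟩ := mem_testD.1 hw <;> cases h
    rw [State.cat_nil]
    exact H hχ

theorem obsPrefix_singleton {e : REvent L} {u : State L} {τ : RTrace L} {w : Option (State L)} :
    ObsPrefix (τ, w) ([e], some u) ↔
      (τ = [] ∧ w = none) ∨ (τ = [e] ∧ (w = none ∨ w = some u)) := by
  constructor
  · rintro (⟨hw, hτ⟩ | h)
    · obtain hτ | ⟨t, rfl, ht⟩ := List.prefix_cons_iff.1 hτ
      · exact Or.inl ⟨hτ, hw⟩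
      · rw [List.prefix_nil.1 ht]
        exact Or.inr ⟨rfl, Or.inl hw⟩
    · cases h
      exact Or.inr ⟨rfl, Or.inr rfl⟩
  · rintro (⟨rfl, rfl⟩ | ⟨rfl, rfl | rfl⟩)
    · exact Or.inl ⟨rfl, List.nil_prefix⟩
    · exact Or.inl ⟨rfl, List.prefix_rfl⟩
    · exact Or.inr rfl

theorem sat_box_send (I : Interp L) (c : L.Chan) (h : L.TName) (θ : Poly L) (ψ : Fml L)
    (v : State L) : (Fml.box (.send c h θ) ψ).sat I v ↔
      ψ.sat I (v.cat [⟨h, c, θ.eval I v, v.now⟩]) := by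
  constructor
  · exact fun H => H _ _ (Or.inr rfl)
  · intro H τ w hw
    have hw' : ObsPrefix (τ, some w) ([⟨h, c, θ.eval I v, v.now⟩], some v) := hw
    obtain ⟨-, h⟩ | ⟨rfl, h | h⟩ := obsPrefix_singleton.1 hw' <;> cases h
    exact H

/-- The ac-box of a program that performs a single communication, nondeterministically chosen by
`i`. -/
theorem acBox_event {ι : Type*} [Nonempty ι] {D : Set (Comp L)} {v : State L}
    {e : ι → REvent L} {u : ι → State L}
    (hD : ∀ τ w, (v, τ, w) ∈ D ↔ ∃ i, ObsPrefix (τ, w) ([e i], some (u i)))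
    (A C P : State L → Prop) : AcBox D A C P v ↔
      C v ∧ (A v → ∀ i, C (v.cat [e i]) ∧ (A (v.cat [e i]) → P ((u i).cat [e i]))) := by
  have hpre (i : ι) (Q : RTrace L → Prop) : (∀ τ', τ' <+: [e i] → Q τ') ↔ Q [] ∧ Q [e i] := by
    refine ⟨fun H => ⟨H _ List.nil_prefix, H _ List.prefix_rfl⟩, fun H τ' h => ?_⟩
    obtain rfl | ⟨t, rfl, ht⟩ := List.prefix_cons_iff.1 h
    · exact H.1
    · rw [List.prefix_nil.1 ht]
      exact H.2
  constructor
  · intro H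
    refine ⟨?_, fun hA i => ⟨?_, fun hA' => ?_⟩⟩
    · have := (H [] none ((hD _ _).2 ⟨Classical.arbitrary ι, Or.inl ⟨rfl, List.nil_prefix⟩⟩)).1
        fun τ' h hne => absurd (List.prefix_nil.1 h) hne
      rwa [State.cat_nil] at this
    · refine (H [e i] _ ((hD _ _).2 ⟨i, Or.inr rfl⟩)).1 ?_
      refine (hpre i _).2 ⟨fun _ => ?_, fun hne => absurd rfl hne⟩
      rwa [State.cat_nil]
    · refine (H [e i] _ ((hD _ _).2 ⟨i, Or.inr rfl⟩)).2 _ rfl ((hpre i _).2 ⟨?_, hA'⟩)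
      rwa [State.cat_nil]
  · rintro ⟨hC, H⟩ τ w hw
    obtain ⟨i, hi⟩ := (hD τ w).1 hw
    obtain ⟨rfl, rfl⟩ | ⟨rfl, hw'⟩ := obsPrefix_singleton.1 hi
    · exact ⟨fun _ => by rwa [State.cat_nil], fun _ h => by cases h⟩
    · constructor
      · intro hA
        have := hA [] List.nil_prefix (List.cons_ne_nil _ _).symm
        rw [State.cat_nil] at this
        exact (H this i).1
      · rintro z rfl hA
        obtain h | h := hw' <;> cases h
        obtain ⟨hA₁, hA₂⟩ := (hpre i _).1 hA
        rw [State.cat_nil] at hA₁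
        exact (H hA₁ i).2 hA₂

theorem sat_acBox_send (I : Interp L) (c : L.Chan) (h : L.TName) (θ : Poly L) (A C ψ : Fml L)
    (v : State L) {e : REvent L} (he : e = ⟨h, c, θ.eval I v, v.now⟩) :
    (Fml.acBox (.send c h θ) A C ψ).sat I v ↔
      C.sat I v ∧ (A.sat I v → C.sat I (v.cat [e]) ∧
        (A.sat I (v.cat [e]) → ψ.sat I (v.cat [e]))) := by
  subst he
  rw [sat_acBox, acBox_event (ι := Unit) (u := fun _ => v)
    (e := fun _ => ⟨h, c, θ.eval I v, v.now⟩)]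
  · simp only [forall_const]
  · exact fun τ w => ⟨fun h => ⟨(), h⟩, fun ⟨_, h⟩ => h⟩

theorem sat_acBox_recv (I : Interp L) (c : L.Chan) (h : L.TName) (x : RVar L) (A C ψ : Fml L)
    (v : State L) :
    (Fml.acBox (.recv c h x) A C ψ).sat I v ↔
      C.sat I v ∧ (A.sat I v → ∀ d : ℝ, C.sat I (v.cat [⟨h, c, d, v.now⟩]) ∧
        (A.sat I (v.cat [⟨h, c, d, v.now⟩]) →
          ψ.sat I ((v.set (rv x) d).cat [⟨h, c, d, v.now⟩]))) :=
  acBox_event (ι := ℝ) (u := fun d => v.set (rv x) d) (e := fun d => ⟨h, c, d, v.now⟩)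
    (fun _ _ => Iff.rfl) _ _ _

theorem eval_pol_const (I : Interp L) (f : L.PolSym 0) (v : State L) :
    (Poly.fn f Fin.elim0).eval I v = I.pol f Fin.elim0 := by
  rw [Poly.eval]
  exact congrArg (I.pol f) (Subsingleton.elim _ _)

theorem sat_box_send_iff_sat_all (c : L.Chan) (h h₀ : L.TName) (hh : h₀ ≠ h) (f : L.PolSym 0)
    (p : L.PSym (Fin 1) fun _ => .trace) (I : Interp L) (v : State L) :
    (Fml.box (.send c h (.fn f Fin.elim0)) (hist c h p)).sat I v ↔
      (Fml.all (tv h₀)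
          (.imp (.eq (s := .trace) (.var h₀)
              (.cat (.var h) (.item c (.fn f Fin.elim0) (.var (gt L)))))
            (hist c h₀ p))).sat I v := by
  rw [sat_box_send]
  have hne : (tv h : Var L) ≠ tv h₀ := fun e => hh (eq_of_heq (Sigma.mk.inj e).2).symm
  have key (d : List (Event L)) :
      (Fml.eq (s := .trace) (.var h₀)
        (.cat (.var h) (.item c (.fn f Fin.elim0) (.var (gt L))))).sat I (v.set (tv h₀) d) ↔
      d = v (tv h) ++ [⟨c, I.pol f Fin.elim0, v.now⟩] := by
    have e₁ : v.set (tv h₀) d (tv h₀) = d := State.set_self v (tv h₀) d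
    have e₂ : v.set (tv h₀) d (tv h) = v (tv h) := State.set_of_ne v (x := tv h₀) d hne
    have e₃ : v.set (tv h₀) d (rv (gt L)) = v.now :=
      State.set_of_ne v (x := tv h₀) (y := rv (gt L)) d (by simp)
    change v.set (tv h₀) d (tv h₀) = v.set (tv h₀) d (tv h) ++
      [⟨c, Poly.eval I (v.set (tv h₀) d) (.fn f Fin.elim0), v.set (tv h₀) d (rv (gt L))⟩] ↔ _
    rw [e₁, e₂, e₃, eval_pol_const]
  have hist_sat (k : L.TName) (u : State L) :
      (hist c k p).sat I u ↔ (fun _ => projT {c} (u (tv k))) ∈ I.pred p := Iff.rfl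
  have hcat : v.cat [⟨h, c, (Poly.fn f Fin.elim0).eval I v, v.now⟩] (tv h) =
      v (tv h) ++ [⟨c, I.pol f Fin.elim0, v.now⟩] := by
    change v (tv h) ++ recorded h _ = _
    rw [eval_pol_const]
    simp [recorded, REvent.event]
  rw [hist_sat, hcat]
  constructor
  · intro H d
    rw [sat_imp, key, hist_sat]
    rintro rfl
    rwa [State.set_self]
  · intro H
    have := H (v (tv h) ++ [⟨c, I.pol f Fin.elim0, v.now⟩])
    rw [sat_imp, key, hist_sat, State.set_self] at this
    exact this rfl

theorem sat_acBox_recv_iff_sat_box_assignAny (c : L.Chan) (h : L.TName) (x : RVar L) (hx : x ≠ gt L)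
    (r q : L.PSym (Fin 1) fun _ => .trace) (ψ : Fml L) (I : Interp L) (v : State L) :
    (Fml.acBox (.recv c h x) (hist c h r) (hist c h q) ψ).sat I v ↔
      (Fml.box (.assignAny x)
        (.acBox (.send c h (.var x)) (hist c h r) (hist c h q) ψ)).sat I v := by
  rw [sat_acBox_recv, sat_box_assignAny]
  have hv (d : ℝ) (k : L.TName) : v.set (rv x) d (tv k) = v (tv k) :=
    State.set_of_ne v (x := rv x) (y := tv k) d (by simp)
  have hs (d : ℝ) := sat_acBox_send I c h (.var x) (hist c h r) (hist c h q) ψ (v.set (rv x) d)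
    (e := ⟨h, c, d, v.now⟩) (by
      have e₁ : Poly.eval I (v.set (rv x) d) (.var x) = d := State.set_self v (rv x) d
      have e₂ : (v.set (rv x) d).now = v.now := by
        refine State.set_of_ne v (x := rv x) (y := rv (gt L)) d fun e => ?_
        exact hx (rv_injective e).symm
      rw [e₁, e₂])
  have hc (p : L.PSym (Fin 1) fun _ => .trace) (d : ℝ) :
      (hist c h p).sat I (v.set (rv x) d) ↔ (hist c h p).sat I v :=
    hist_congr I c h p (hv d h)
  have hc' (p : L.PSym (Fin 1) fun _ => .trace) (d : ℝ) (τ : RTrace L) :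
      (hist c h p).sat I ((v.set (rv x) d).cat τ) ↔ (hist c h p).sat I (v.cat τ) :=
    hist_congr I c h p (State.cat_tv_congr τ (hv d h))
  simp only [hs, hc, hc']
  exact ⟨fun H d => ⟨H.1, fun hA => H.2 hA d⟩, fun H => ⟨(H 0).1, fun hA d => (H d).2 hA⟩⟩

theorem sat_acBox_noCom (a : L.ASym) (A C ψ : Fml L) (I : Interp L) (v : State L) :
    (Fml.acBox (.noCom a) A C ψ).sat I v ↔
      C.sat I v ∧ (A.sat I v → (Fml.box (.noCom a) ψ).sat I v) := by
  have hnil : ∀ τ w, (v, τ, w) ∈ (Prog.noCom a).sem I → τ = [] := by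
    intro τ w h
    have := projR_eq_nil.1 (I.prog_writes _ _ _ _ _ _ h)
    exact List.eq_nil_iff_forall_not_mem.2 fun e he => this e he fun h => h
  constructor
  · refine fun H => ⟨?_, fun hA τ w h => (H τ _ h).2 w rfl ?_⟩
    · have := (H [] none (I.prog_total _ _ _ ⟨rfl, rfl⟩)).1
        fun τ' h hne => absurd (List.prefix_nil.1 h) hne
      rwa [State.cat_nil] at this
    · obtain rfl := hnil _ _ h
      intro τ' h
      rwa [List.prefix_nil.1 h, State.cat_nil]
  · intro H τ w h
    obtain rfl := hnil _ _ h
    refine ⟨fun _ => by rw [State.cat_nil]; exact H.1, ?_⟩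
    rintro u rfl hA
    have := hA [] List.prefix_rfl
    rw [State.cat_nil] at this
    exact H.2 this _ _ h

/-- Adding `μ' = 1` to an ODE system leaves its runs unchanged, as global time evolves along with
every system. -/
theorem odeD_cons_time (I : Interp L) {n : ℕ} (x : Fin n → RVar L) (θ : Fin n → Poly L)
    (χ : RFml L) :
    odeD I (Fin.cons (α := fun _ => RVar L) (gt L) x)
      (Fin.cons (α := fun _ => Poly L) (.rat 1) θ) χ = odeD I x θ χ := by
  have h₁ (y : Var L) :
      (∀ i, y ≠ rv (Fin.cons (α := fun _ => RVar L) (gt L) x i : RVar L).prime) ↔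
        y ≠ rv (gt L).prime ∧ ∀ i, y ≠ rv (x i).prime := Fin.forall_fin_succ
  have h₂ (u : State L) :
      (∀ i, (u (rv (Fin.cons (α := fun _ => RVar L) (gt L) x i : RVar L).prime) : ℝ) =
          (Fin.cons (α := fun _ => Poly L) (.rat 1) θ i : Poly L).eval I u) ↔
        (u (rv (gt L).prime) : ℝ) = (1 : ℚ) ∧ ∀ i, (u (rv (x i).prime) : ℝ) = (θ i).eval I u :=
    Fin.forall_fin_succ
  have h₃ (y : Var L) :
      (∀ i, y ≠ rv (Fin.cons (α := fun _ => RVar L) (gt L) x i : RVar L) ∧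
          y ≠ rv (Fin.cons (α := fun _ => RVar L) (gt L) x i : RVar L).prime) ↔
        (y ≠ rv (gt L) ∧ y ≠ rv (gt L).prime) ∧ ∀ i, y ≠ rv (x i) ∧ y ≠ rv (x i).prime :=
    Fin.forall_fin_succ
  have h₄ (σ : ℝ → State L) (r ζ : ℝ) :
      (∀ i, HasDerivWithinAt
          (fun t => (σ t (rv (Fin.cons (α := fun _ => RVar L) (gt L) x i : RVar L)) : ℝ))
          (σ ζ (rv (Fin.cons (α := fun _ => RVar L) (gt L) x i : RVar L).prime) : ℝ)
          (Set.Icc 0 r) ζ) ↔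
        HasDerivWithinAt (fun t => (σ t (rv (gt L)) : ℝ)) (σ ζ (rv (gt L).prime) : ℝ)
          (Set.Icc 0 r) ζ ∧
        ∀ i, HasDerivWithinAt (fun t => (σ t (rv (x i)) : ℝ)) (σ ζ (rv (x i).prime) : ℝ)
          (Set.Icc 0 r) ζ :=
    Fin.forall_fin_succ
  refine congrArg (least L ∪ ·) (Set.ext fun k => ?_)
  refine and_congr Iff.rfl (exists_congr fun r => exists_congr fun σ => ?_)
  refine and_congr Iff.rfl (and_congr (forall_congr' fun y => ?_) (and_congr Iff.rfl
    (forall₂_congr fun ζ _ => ?_)))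
  · rw [h₁]
    tauto
  · rw [h₂, h₄, Rat.cast_one]
    simp only [h₃]
    exact ⟨fun ⟨a, b, c, d, e, f⟩ =>
        ⟨a, b.2, c, fun y h h' h'' => d y h h' ⟨⟨h, h'⟩, h''⟩, e, f.2⟩,
      fun ⟨a, b, c, d, e, f⟩ => ⟨a, ⟨a, b⟩, c, fun y h h' h'' => d y h h' h''.2, e, e, f⟩⟩


/-! ### The axioms and rules -/

theorem Axm.wf {φ : Fml L} (h : Axm φ) : φ.WF := by
  cases h with
  | assign | nondetAssign | test => exact wf_iff.2 ⟨⟨trivial, trivial⟩, by trivial⟩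
  | boxesDual S a p =>
    exact wf_iff.2 ⟨⟨trivial, trivial⟩,
      wf_acBox trivial trivial trivial trivial traceOnly_tru traceOnly_tru⟩
  | acComposition S a b r q p =>
    have hr := traceOnly_ac S r
    have hq := traceOnly_ac S q
    exact wf_iff.2 ⟨wf_acBox ⟨trivial, trivial⟩ trivial trivial trivial hr hq,
      wf_acBox trivial trivial trivial (wf_acBox trivial trivial trivial trivial hr hq) hr hq⟩
  | acChoice S a b r q p =>
    have hr := traceOnly_ac S r
    have hq := traceOnly_ac S q
    exact wf_iff.2 ⟨wf_acBox ⟨trivial, trivial⟩ trivial trivial trivial hr hq,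
      wf_acBox trivial trivial trivial trivial hr hq,
      wf_acBox trivial trivial trivial trivial hr hq⟩
  | acIteration S a r q p =>
    have hr := traceOnly_ac S r
    have hq := traceOnly_ac S q
    have hloop : (Fml.acBox (.loop (.pc a)) (S.ac r) (S.ac q) (S.post p)).WF :=
      wf_acBox (α := .loop (.pc a)) trivial trivial trivial trivial hr hq
    exact wf_iff.2 ⟨hloop, wf_acBox trivial trivial trivial trivial hr hq,
      wf_acBox trivial trivial trivial hloop hr hq⟩
  | assumptionWeak S a r r₁ r₂ q₁ q₂ p =>
    have hac := traceOnly_ac S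
    refine wf_imp.2 ⟨⟨wf_acBox trivial trivial ⟨⟨⟨trivial, trivial⟩, trivial⟩,
      ⟨⟨trivial, trivial⟩, trivial⟩⟩ trivial traceOnly_tru ?_, ?_⟩, ?_⟩
    · exact (((hac _).and (hac _)).imp (hac _)).and (((hac _).and (hac _)).imp (hac _))
    · exact wf_acBox trivial ⟨trivial, trivial⟩ ⟨trivial, trivial⟩ trivial
        ((hac _).and (hac _)) ((hac _).and (hac _))
    · exact wf_acBox trivial trivial ⟨trivial, trivial⟩ trivial (hac _) ((hac _).and (hac _))
  | acDropComp S a b Ya za r q p =>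
    have hr := traceOnly_ac S r
    have hq := traceOnly_ac S q
    exact wf_imp.2 ⟨wf_acBox trivial trivial trivial trivial hr hq,
      wf_acBox (wf_par_const ..) trivial trivial trivial hr hq⟩
  | gtime x hx hμ f q p =>
    exact wf_iff.2 ⟨⟨hx, trivial⟩,
      Fin.cons_injective_iff.2 ⟨fun ⟨i, hi⟩ => hμ i hi, hx⟩, trivial⟩
  | send => exact wf_iff.2 ⟨⟨trivial, trivial⟩, wf_imp.2 ⟨trivial, trivial⟩⟩
  | acCom c h f r q p =>
    exact wf_iff.2 ⟨wf_acBox trivial trivial trivial trivial (traceOnly_hist c h r)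
      (traceOnly_hist c h q), trivial, wf_imp.2 ⟨trivial, trivial, trivial,
        wf_imp.2 ⟨trivial, trivial⟩⟩⟩
  | comDual c h x hx r q p =>
    have hr := traceOnly_hist c h r
    have hq := traceOnly_hist c h q
    exact wf_iff.2 ⟨wf_acBox trivial trivial trivial trivial hr hq, trivial,
      wf_acBox trivial trivial trivial trivial hr hq⟩
  | acNoCom S a r q p =>
    exact wf_iff.2 ⟨wf_acBox trivial trivial trivial trivial (traceOnly_ac S r)
      (traceOnly_ac S q), trivial, wf_imp.2 ⟨trivial, trivial, trivial⟩⟩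
  | acWeak S a r q p =>
    have hr := traceOnly_ac S r
    have hq := traceOnly_ac S q
    exact wf_iff.2 ⟨wf_acBox trivial trivial trivial trivial hr hq, trivial,
      wf_acBox trivial trivial trivial ⟨trivial, wf_imp.2 ⟨trivial, trivial⟩⟩ hr hq⟩
  | acInduction S a r q p =>
    have hr := traceOnly_ac S r
    have hq := traceOnly_ac S q
    exact wf_iff.2 ⟨wf_acBox (α := .loop (.pc a)) trivial trivial trivial trivial hr hq,
      wf_acBox trivial trivial trivial trivial hr hq,
      wf_acBox (α := .loop (.pc a)) trivial trivial trivial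
        (wf_imp.2 ⟨trivial, wf_acBox trivial trivial trivial trivial hr hq⟩) hr traceOnly_tru⟩
  | acModalMP S a r q₁ q₂ p₁ p₂ =>
    have hac := traceOnly_ac S
    exact wf_imp.2 ⟨wf_acBox trivial trivial (wf_imp.2 ⟨trivial, trivial⟩)
        (wf_imp.2 ⟨trivial, trivial⟩) (hac r) ((hac q₁).imp (hac q₂)),
      wf_imp.2 ⟨wf_acBox trivial trivial trivial trivial (hac r) (hac q₁),
        wf_acBox trivial trivial trivial trivial (hac r) (hac q₂)⟩⟩

theorem Axm.valid {φ : Fml L} (h : Axm φ) : φ.Valid := by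
  intro I v
  have hreg (a : L.ASym) : Regular ((Prog.pc a).sem I) := Regular.prog I a _ _
  cases h with
  | assign x f p =>
    rw [sat_iff, sat_box_assign, eval_pol_const]
    refine iff_of_eq (congrArg (· ∈ I.pred p) (funext fun _ => ?_))
    refine (State.set_self v (rv x) _).trans ?_
    exact congrArg (I.pol f) (Subsingleton.elim _ _)
  | nondetAssign S x p =>
    rw [sat_iff, sat_box_assignAny]
    exact Iff.rfl
  | test S q p =>
    rw [sat_iff, sat_box_test, sat_imp]
    refine imp_congr_left (iff_of_eq (congrArg (· ∈ I.rpred q) (Subsingleton.elim _ _)))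
  | boxesDual S a p =>
    rw [sat_iff]
    refine ⟨fun H τ w h => ⟨fun _ => rfl, ?_⟩, fun H τ w h => ?_⟩
    · rintro u rfl -
      exact H τ u h
    · exact (H τ _ h).2 w rfl fun _ _ => rfl
  | acComposition S a b r q p =>
    rw [sat_iff]
    exact acBox_seqD (hreg a) (hreg b) (traceOnly_ac S r I) (traceOnly_ac S q I) _ v
  | acChoice S a b r q p =>
    rw [sat_iff]
    exact ⟨fun H => ⟨fun τ w h => H τ w (Or.inl h), fun τ w h => H τ w (Or.inr h)⟩,
      fun H τ w h => h.elim (H.1 τ w) (H.2 τ w)⟩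
  | acIteration S a r q p =>
    rw [sat_iff, sat_and, sat_acBox _ .zero, sem_zero]
    exact acBox_loop (hreg a) (traceOnly_ac S r I) (traceOnly_ac S q I) _ v
  | assumptionWeak S a r r₁ r₂ q₁ q₂ p =>
    rw [sat_imp]
    rintro ⟨hK, H⟩
    refine acBox_assumptionWeak (I.prog_prefixClosed _ _ _) ?_ H
    intro τ w h
    refine ⟨fun _ hA hC => ?_, fun _ _ _ => trivial⟩
    have hcomp := (hK τ w h).1 fun _ _ _ => rfl
    rw [compCond, sat_and, sat_imp, sat_imp] at hcomp
    exact ⟨hcomp.2 ⟨hA, hC.2⟩, hcomp.1 ⟨hA, hC.1⟩⟩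
  | acDropComp S a b Ya za r q p =>
    rw [sat_imp]
    exact acBox_par_of_left I S a b Ya za _ r q p v
  | gtime x hx hμ f q p =>
    rw [sat_iff]
    simp only [Fml.sat, Prog.sem, odeD_cons_time]
  | send c h h₀ hh f p =>
    rw [sat_iff]
    exact sat_box_send_iff_sat_all c h h₀ hh f p I v
  | acCom c h f r q p =>
    rw [sat_iff, sat_acBox_send _ _ _ _ _ _ _ _ rfl, sat_and, sat_imp, sat_box_send, sat_and,
      sat_imp]
  | comDual c h x hx r q p =>
    rw [sat_iff]
    exact sat_acBox_recv_iff_sat_box_assignAny c h x hx r q _ I v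
  | acNoCom S a r q p =>
    rw [sat_iff, sat_and, sat_imp]
    exact sat_acBox_noCom a _ _ _ I v
  | acWeak S a r q p =>
    rw [sat_iff, sat_and, sat_acBox _ _ _ _ (.and _ _),
      show (Fml.and (S.ac q) ((S.ac r).imp (S.post p))).sat I = fun u =>
        (S.ac q).sat I u ∧ ((S.ac r).sat I u → (S.post p).sat I u) from
        funext fun u => propext (and_congr_right fun _ => sat_imp I _ _ u)]
    exact acBox_weak (hreg a) (traceOnly_ac S r I) (traceOnly_ac S q I) _ v
  | acInduction S a r q p =>
    rw [sat_iff, sat_and, sat_acBox _ .zero, sem_zero, sat_acBox _ _ _ .tru, sat_imp_eq,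
      sat_tru_eq]
    exact acBox_induction (hreg a) (traceOnly_ac S r I) (traceOnly_ac S q I) _ v
  | acModalMP S a r q₁ q₂ p₁ p₂ =>
    rw [sat_imp, sat_imp, sat_acBox, sat_imp_eq, sat_imp_eq]
    exact AcBox.mp

theorem Rule.locallySound {Γ : List (Fml L)} {φ : Fml L} (h : Rule Γ φ) : LocallySound Γ φ := by
  intro I hΓ v
  cases h with
  | MP φ =>
    exact (sat_imp I φ _ v).1 (hΓ _ List.mem_cons_self v)
      (hΓ _ (List.mem_cons_of_mem _ List.mem_cons_self) v)
  | acG S a r q p =>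
    have h := hΓ _ (List.mem_singleton_self _)
    exact fun τ w _ => ⟨fun _ => (h _).1, fun u _ _ => (h _).2⟩

theorem Rule.wf {Γ : List (Fml L)} {φ : Fml L} (h : Rule Γ φ) (hΓ : ∀ γ ∈ Γ, γ.WF) : φ.WF := by
  cases h with
  | MP φ ψ => exact (wf_imp.1 (hΓ _ List.mem_cons_self)).2
  | acG S a r q p =>
    exact wf_acBox trivial trivial trivial trivial (traceOnly_ac S r) (traceOnly_ac S q)

theorem Derivable.wf_and_valid {φ : Fml L} (h : Derivable φ) : φ.WF ∧ φ.Valid := by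
  induction h with
  | axm h => exact ⟨h.wf, h.valid⟩
  | rule h _ ih =>
    exact ⟨h.wf fun γ hγ => (ih γ hγ).1,
      fun I => h.locallySound I fun γ hγ => (ih γ hγ).2 I⟩

end DLCHP

theorem mainTheorem4 (L : DLCHP.Vocab) :
    (∀ φ : DLCHP.Fml L, DLCHP.Axm φ → φ.WF ∧ φ.Valid) ∧
    (∀ (Γ : List (DLCHP.Fml L)) (φ : DLCHP.Fml L), DLCHP.Rule Γ φ → DLCHP.LocallySound Γ φ) ∧
    (∀ φ : DLCHP.Fml L, DLCHP.Derivable φ → φ.WF ∧ φ.Valid) :=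
  ⟨fun _ h => ⟨h.wf, h.valid⟩, fun _ _ h => h.locallySound, fun _ h => h.wf_and_valid⟩
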